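/- Let $X=\{X_k\}_{k\in\mathbb Z}$ be a centered stationary Gaussian family of real random variables with unit variance, and put $\rho(k)=\mathbb E(X_0X_k)$. Let $\gamma=N(0,1)$ be the standard Gaussian measure on $\mathbb R$, let $H_m(x)=(-1)^m e^{x^2/2}\frac{d^m}{dx^m}e^{-x^2/2}$ be the Hermite polynomials, and let $\mathbb D^{2,4}(\mathbb R,\gamma)$ be the closure of the space of smooth functions that are bounded together with all their derivatives, with respect to the norm $\|f\|_{2,4}=\big(\sum_{i=0}^{2}\int_{\mathbb R}|f^{(i)}|^4\,d\gamma\big)^{1/4}$. Let $g\in\mathbb D^{2,4}(\mathbb R,\gamma)$ have Hermite rank $1$, that is, $g=\sum_{m=1}^\infty c_mH_m$ in $L^2(\mathbb R,\gamma)$ with $c_1\neq 0$. Suppose that $\sum_{j\in\mathbb Z}|\rho(j)|<\infty$ and that $$\sigma^2:=\sum_{m=1}^\infty m!\,c_m^2\sum_{k\in\mathbb Z}\rho(k)^m>0 .$$ For $n\ge 1$ set $Y_n=\frac1{\sqrt n}\sum_{j=1}^n g(X_j)$ and $\sigma_n=\sqrt{\mathbb E(Y_n^2)}$. Then $\sigma_n>0$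 for every $n\ge1$, and there is a constant $C$, not depending on $n$, such that for all $n\ge 1$ $$d_{\rm TV}(Y_n/\sigma_n,Z)\le C\,n^{-1/2},$$ where $Z$ is an $N(0,1)$ random variable and $d_{\rm TV}(F,G)=\sup_{B}|P(F\in B)-P(G\in B)|$, the supremum being over all Borel sets $B\subset\mathbb R$. -/

import Mathlib

open MeasureTheory ProbabilityTheory Filter Topology
open scoped ENNReal Nat

noncomputable section

namespace BreuerMajor

/-- The standard Gaussian measure `γ` on the real line. -/
abbrev stdGaussian : Measure ℝ := gaussianReal 0 1

/-- The class `C_b^∞(ℝ)`: smooth functions that are bounded together with all their derivatives. -/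
def IsSmoothBounded (f : ℝ → ℝ) : Prop :=
  ContDiff ℝ (⊤ : ℕ∞) f ∧ ∀ i : ℕ, ∃ M : ℝ, ∀ x : ℝ, |iteratedDeriv i f x| ≤ M

/-- Membership `g ∈ 𝔻^{k,p}(ℝ,γ)`, for `1 ≤ p < ∞`: the Gaussian Sobolev space is the closure of
`C_b^∞(ℝ)` for the norm `‖f‖_{k,p}^p = ∑_{i ≤ k} ∫ |f^{(i)}|^p dγ`. So `g` belongs to it when
there are functions `D 0 = g, D 1, …, D k` in `L^p(γ)` (the derivatives of `g`) and a sequence in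
`C_b^∞(ℝ)` whose `i`-th derivatives converge to `D i` in `L^p(γ)` for every `i ≤ k`. -/
def MemGaussianSobolev (k : ℕ) (p : ℝ≥0∞) (g : ℝ → ℝ) : Prop :=
  ∃ D : ℕ → ℝ → ℝ, D 0 = g ∧ (∀ i ≤ k, MemLp (D i) p stdGaussian) ∧
    ∃ f : ℕ → ℝ → ℝ, (∀ m, IsSmoothBounded (f m)) ∧
      ∀ i ≤ k, Tendsto (fun m => eLpNorm (iteratedDeriv i (f m) - D i) p stdGaussian)
        atTop (𝓝 0)

/-- The (probabilists') Hermite polynomial `H_m`, as a function on the real line. -/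
def hermiteFun (m : ℕ) (x : ℝ) : ℝ := Polynomial.aeval x (Polynomial.hermite m)

/-- `g ∈ L²(γ)` has Hermite rank `d`, with Hermite expansion `g = ∑_{m ≥ d} c_m H_m` in `L²(γ)`
and `c_d ≠ 0`. The coefficients `c_m`, `m < d`, are set to `0`. -/
structure HasHermiteRank (g : ℝ → ℝ) (d : ℕ) (c : ℕ → ℝ) : Prop where
  memLp : MemLp g 2 stdGaussian
  coeff_eq_zero : ∀ m < d, c m = 0
  coeff_ne_zero : c d ≠ 0
  tendsto : Tendsto
    (fun N : ℕ => eLpNorm (fun x => g x - ∑ m ∈ Finset.range N, c m * hermiteFun m x) 2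
      stdGaussian) atTop (𝓝 0)

/-- `X = (X_k)_{k ∈ ℤ}` is a centered stationary Gaussian family with unit variance. For a
centered Gaussian family, stationarity says that `E(X_j X_{j+k})` does not depend on `j`. -/
structure IsStationaryGaussian {Ω : Type*} [MeasurableSpace Ω] (X : ℤ → Ω → ℝ)
    (P : Measure Ω) : Prop where
  gaussian : IsGaussianProcess X P
  centered : ∀ k, ∫ ω, X k ω ∂P = 0
  stationary : ∀ j k, ∫ ω, X j ω * X (j + k) ω ∂P = ∫ ω, X 0 ω * X k ω ∂P
  unit_variance : ∫ ω, X 0 ω ^ 2 ∂P = 1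

/-- The covariance function `ρ(k) = E(X_0 X_k)`. -/
def rho {Ω : Type*} [MeasurableSpace Ω] (X : ℤ → Ω → ℝ) (P : Measure Ω) (k : ℤ) : ℝ :=
  ∫ ω, X 0 ω * X k ω ∂P

/-- The limiting variance `σ² = ∑_m m! c_m² ∑_{k ∈ ℤ} ρ(k)^m`. -/
def limitVariance (c : ℕ → ℝ) (ρ : ℤ → ℝ) : ℝ :=
  ∑' m : ℕ, (m ! : ℝ) * c m ^ 2 * ∑' k : ℤ, ρ k ^ m

/-- The normalized sum `Y_n = n^{-1/2} ∑_{j=1}^n g(X_j)`. -/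
def Y {Ω : Type*} (g : ℝ → ℝ) (X : ℤ → Ω → ℝ) (n : ℕ) (ω : Ω) : ℝ :=
  (1 / √(n : ℝ)) * ∑ j ∈ Finset.Icc 1 n, g (X (j : ℤ) ω)

/-- `σ_n = √(E(Y_n²))`. -/
def sigma {Ω : Type*} [MeasurableSpace Ω] (g : ℝ → ℝ) (X : ℤ → Ω → ℝ) (P : Measure Ω)
    (n : ℕ) : ℝ :=
  √(∫ ω, Y g X n ω ^ 2 ∂P)

/-- The total variation distance `sup_B |μ(B) - ν(B)|` between two probability measures on `ℝ`,
the supremum being over all Borel sets. -/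
def tvDist (μ ν : Measure ℝ) : ℝ :=
  ⨆ B : {B : Set ℝ // MeasurableSet B}, |μ.real B - ν.real B|

end BreuerMajor

end

/-!
The proof combines Stein's method with an interpolation between a Gaussian vector and an
independent copy of it.

Let `x` be a centered Gaussian vector with covariance matrix `Γ`, and `y` an independent copy. The
rotation `x_t = cos t • x + sin t • y` joins `x` to `y`, the law of `(x, y)` is invariant under it,
and differentiating in `t` and integrating by parts gives the covariance formula
`Cov(Φ(x), Ψ(x)) = ∫_0^{π/2} sin t ∑_{j,k} Γ_{jk} E[∂_jΦ(x) ∂_kΨ(x_t)] dt`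
(`IsUnitGaussian.covariance_eq_integral`). It is used twice.

* Applied to `S = ∑ i, g (x i)` and a function of `S` built from the solution `f` of Stein's
  equation, it writes `E[h(S/√v)] - E[h(Z)]` as a covariance between a bounded variable and the
  kernel `T_t = ∑_{j,k} Γ_{jk} g'(x_j) g'(x_{t,k})`, averaged over `t` and divided by `v = Var S`
  (`IsUnitGaussian.abs_integral_sub_le`).
* Applied to `T_t` itself, as a function of the doubled vector `(x, x_t)`, it bounds `Var T_t` by a
  sum over four indices of products of three covariances. If the rows of `|Γ|` have sums at most
  `R`, this is at most `4 A R³ n`, where `A` bounds the fourth moments of `g'` and `g''`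
  (`IsUnitGaussian.variance_kernel_le`).

So the error is of order `√n / Var S` for smooth `g`, with a constant that depends only on `R` and
on the `L⁴(γ)` norms of `g'` and `g''`; it extends to `g ∈ 𝔻^{2,4}` by approximation
(`MemGaussianSobolev.exists_abs_integral_sub_le`), since continuous test functions determine the
total variation distance (`tvDist_le`).

It remains to see that `Var S` grows linearly. The Hermite expansion gives
`Cov(g(X_0), g(X_k)) = ∑ m! c_m² ρ(k)^m`, which is summable in `k` with sum `σ²`, and `Var S / n`
tends to `σ²` by a Cesàro argument (`tendsto_doubleSum_div`). No `Var S` vanishes, because this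
would force `Var S` to vanish for all multiples of `n` as well
(`IsStationaryGaussian.doubleSum_pos`).
-/

noncomputable section

namespace BreuerMajor

/-! ### Gaussian integration by parts -/

lemma hasDerivAt_gaussianPDFReal (x : ℝ) :
    HasDerivAt (gaussianPDFReal 0 1) (-x * gaussianPDFReal 0 1 x) x := by
  have h : HasDerivAt (fun x : ℝ => (√(2 * Real.pi))⁻¹ * Real.exp (-x ^ 2 / 2))
      ((√(2 * Real.pi))⁻¹ * (Real.exp (-x ^ 2 / 2) * (-(2 * x) / 2))) x := by
    have h1 : HasDerivAt (fun x : ℝ => -x ^ 2 / 2) (-(2 * x) / 2) x := by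
      simpa using ((hasDerivAt_pow 2 x).neg).div_const 2
    exact (h1.exp).const_mul _
  have e : gaussianPDFReal 0 1 = fun x : ℝ => (√(2 * Real.pi))⁻¹ * Real.exp (-x ^ 2 / 2) := by
    ext y; simp [gaussianPDFReal]
  rw [e]
  convert h using 1
  ring

lemma integrable_stdGaussian_iff {f : ℝ → ℝ} :
    Integrable f stdGaussian ↔ Integrable (fun x => gaussianPDFReal 0 1 x * f x) := by
  rw [stdGaussian, gaussianReal_of_var_ne_zero 0 one_ne_zero,
    integrable_withDensity_iff_integrable_smul₀' (measurable_gaussianPDF 0 1).aemeasurable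
      (ae_of_all _ fun _ => gaussianPDF_lt_top)]
  simp [toReal_gaussianPDF]

lemma integral_stdGaussian (f : ℝ → ℝ) :
    ∫ x, f x ∂stdGaussian = ∫ x, gaussianPDFReal 0 1 x * f x := by
  rw [stdGaussian, integral_gaussianReal_eq_integral_smul one_ne_zero]
  simp

/-- Stein's lemma for the standard Gaussian measure. -/
lemma integral_mul_stdGaussian {f f' : ℝ → ℝ} (hf : ∀ x, HasDerivAt f (f' x) x)
    (h0 : Integrable f stdGaussian) (h1 : Integrable (fun x => x * f x) stdGaussian)
    (h2 : Integrable f' stdGaussian) :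
    ∫ x, x * f x ∂stdGaussian = ∫ x, f' x ∂stdGaussian := by
  rw [integrable_stdGaussian_iff] at h0 h1 h2
  rw [integral_stdGaussian, integral_stdGaussian]
  have := integral_mul_deriv_eq_deriv_mul_of_integrable (u := gaussianPDFReal 0 1)
    (u' := fun x => -x * gaussianPDFReal 0 1 x) (v := f) (v' := f')
    (fun x _ => hasDerivAt_gaussianPDFReal x) (fun x _ => hf x) h2
    (by convert h1.neg using 1; ext x; simp; ring) h0
  rw [this, ← integral_neg]
  congr 1; ext x; ring

section UnitGaussian

variable {ι : Type*}

/-- `μ` is the law of a centered Gaussian vector with unit variances and covariance matrix `Γ`,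
which may be singular. -/
structure IsUnitGaussian (μ : Measure (ι → ℝ)) (Γ : ι → ι → ℝ) : Prop where
  gaussian : IsGaussian μ
  mean : ∀ i, ∫ x, x i ∂μ = 0
  cov : ∀ i j, ∫ x, x i * x j ∂μ = Γ i j
  unit : ∀ i, Γ i i = 1

namespace IsUnitGaussian

variable {μ : Measure (ι → ℝ)} {Γ : ι → ι → ℝ}

lemma isProbabilityMeasure (hμ : IsUnitGaussian μ Γ) : IsProbabilityMeasure μ :=
  have := hμ.gaussian
  inferInstance

lemma symm (hμ : IsUnitGaussian μ Γ) (i j : ι) : Γ i j = Γ j i := by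
  rw [← hμ.cov, ← hμ.cov]; simp_rw [mul_comm]

lemma map_eval (hμ : IsUnitGaussian μ Γ) (i : ι) : μ.map (fun x => x i) = stdGaussian := by
  have := hμ.gaussian
  have h := IsGaussian.map_eq_gaussianReal (μ := μ)
    (ContinuousLinearMap.proj i : (ι → ℝ) →L[ℝ] ℝ)
  have hv : Var[fun x : ι → ℝ => x i; μ] = 1 := by
    rw [variance_of_integral_eq_zero (measurable_pi_apply i).aemeasurable (hμ.mean i)]
    simpa [hμ.unit, sq] using hμ.cov i i
  have e : (⇑(ContinuousLinearMap.proj i : (ι → ℝ) →L[ℝ] ℝ)) = fun x => x i := rfl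
  rw [e, hv, hμ.mean i] at h
  simpa using h

variable [Fintype ι]

lemma memLp_eval (hμ : IsUnitGaussian μ Γ) (i : ι) (p : ℝ≥0∞) (hp : p ≠ ∞) :
    MemLp (fun x : ι → ℝ => x i) p μ :=
  have := hμ.gaussian
  IsGaussian.memLp_dual μ (ContinuousLinearMap.proj i : (ι → ℝ) →L[ℝ] ℝ) p hp

lemma integrable_eval (hμ : IsUnitGaussian μ Γ) (i : ι) :
    Integrable (fun x : ι → ℝ => x i) μ :=
  memLp_one_iff_integrable.1 (hμ.memLp_eval i 1 (by simp))

/-- Regression on the `i`-th coordinate: under `μ`, the residual `x - x i • Γ i` is uncorrelated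
with `x i`, hence independent of it. -/
lemma exists_map_eq_prod (hμ : IsUnitGaussian μ Γ) (i : ι) :
    ∃ ν : Measure (ι → ℝ), IsProbabilityMeasure ν ∧
      μ.map (fun x => (x i, x - x i • Γ i)) = stdGaussian.prod ν := by
  have := hμ.gaussian
  have hind : IndepFun (fun x : ι → ℝ => x i) (fun x => x - x i • Γ i) μ := by
    have h : HasGaussianLaw (fun x : ι → ℝ => ((fun _ : Unit => x i), fun k => x k - x i * Γ i k))
        μ := by
      let L : (ι → ℝ) →L[ℝ] ((Unit → ℝ) × (ι → ℝ)) :=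
        (ContinuousLinearMap.pi fun _ : Unit => ContinuousLinearMap.proj i).prod
          (ContinuousLinearMap.pi fun k => ContinuousLinearMap.proj k -
            Γ i k • ContinuousLinearMap.proj i)
      have := (IsGaussian.hasGaussianLaw_id (μ := μ)).map L
      have e : (fun x : ι → ℝ => ((fun _ : Unit => x i), fun k => x k - x i * Γ i k)) =
          L ∘ id := by
        funext x
        refine Prod.ext ?_ ?_
        · ext; simp [L]
        · ext; simp [L, mul_comm]
      rw [e]
      exact this
    have := h.indepFun_of_covariance_eval (X := fun (_ : Unit) (x : ι → ℝ) => x i)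
      (Y := fun k (x : ι → ℝ) => x k - x i * Γ i k) (fun _ k => ?_)
    · exact this.comp (measurable_pi_apply ()) measurable_id
    · have hk : MemLp (fun x : ι → ℝ => x k - x i * Γ i k) 2 μ :=
        (hμ.memLp_eval k 2 (by simp)).sub ((hμ.memLp_eval i 2 (by simp)).mul_const _)
      rw [covariance_eq_sub (hμ.memLp_eval i 2 (by simp)) hk]
      simp only [Pi.mul_apply, hμ.mean i, zero_mul, sub_zero, mul_sub]
      have h1 : Integrable (fun x : ι → ℝ => x i * x k) μ :=
        (hμ.memLp_eval i 2 (by simp)).integrable_mul (hμ.memLp_eval k 2 (by simp))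
      have h2 : Integrable (fun x : ι → ℝ => x i * (x i * Γ i k)) μ := by
        simp_rw [← mul_assoc]
        exact ((hμ.memLp_eval i 2 (by simp)).integrable_mul
          (hμ.memLp_eval i 2 (by simp))).mul_const _
      rw [integral_sub h1 h2, hμ.cov]
      simp_rw [← mul_assoc]
      rw [integral_mul_const, hμ.cov, hμ.unit]
      ring
  refine ⟨μ.map fun x => x - x i • Γ i, Measure.isProbabilityMeasure_map (by fun_prop), ?_⟩
  rw [(indepFun_iff_map_prod_eq_prod_map_map (measurable_pi_apply i).aemeasurable
    (by fun_prop)).1 hind, hμ.map_eval]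

/-- Gaussian integration by parts: Stein's lemma in the variable `x i`, the residual of the
regression on it being fixed. The derivative is taken in the direction `Γ i`. -/
lemma integral_eval_mul (hμ : IsUnitGaussian μ Γ) (i : ι) {F : (ι → ℝ) → ℝ}
    {F' : (ι → ℝ) → (ι → ℝ) →L[ℝ] ℝ} (hF : ∀ x, HasFDerivAt F (F' x) x)
    (h0 : Integrable F μ) (h1 : Integrable (fun x => x i * F x) μ)
    (h2 : Integrable (fun x => F' x (Γ i)) μ) :
    ∫ x, x i * F x ∂μ = ∫ x, F' x (Γ i) ∂μ := by
  obtain ⟨ν, hν, hmap⟩ := hμ.exists_map_eq_prod i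
  have hT : Measurable (fun x : ι → ℝ => (x i, x - x i • Γ i)) := by fun_prop
  have hμT : μ = (stdGaussian.prod ν).map (fun p => p.1 • Γ i + p.2) := by
    rw [← hmap, Measure.map_map (by fun_prop) hT]
    conv_lhs => rw [← Measure.map_id (μ := μ)]
    congr 1
    ext x k
    simp
  have hS : Measurable (fun p : ℝ × (ι → ℝ) => p.1 • Γ i + p.2) := by fun_prop
  have key : ∀ G : (ι → ℝ) → ℝ, Integrable G μ →
      Integrable (fun p : ℝ × (ι → ℝ) => G (p.1 • Γ i + p.2)) (stdGaussian.prod ν) := by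
    intro G hG
    rw [hμT] at hG
    exact (integrable_map_measure hG.aestronglyMeasurable hS.aemeasurable).1 hG
  have key2 : ∀ G : (ι → ℝ) → ℝ, Integrable G μ →
      ∫ x, G x ∂μ = ∫ w, ∫ s, G (s • Γ i + w) ∂stdGaussian ∂ν := by
    intro G hG
    have hG' := hG
    rw [hμT] at hG'
    rw [← integral_prod_symm _ (key G hG)]
    conv_lhs => rw [hμT]
    rw [integral_map hS.aemeasurable hG'.aestronglyMeasurable]
  have h1' : Integrable (fun p : ℝ × (ι → ℝ) => p.1 * F (p.1 • Γ i + p.2)) (stdGaussian.prod ν) := by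
    rw [← hmap, integrable_map_measure _ hT.aemeasurable]
    · convert h1 using 2 with x
      simp
    · rw [hmap]
      exact measurable_fst.aestronglyMeasurable.mul (key F h0).aestronglyMeasurable
  have h1'' : ∫ x, x i * F x ∂μ = ∫ w, ∫ s, s * F (s • Γ i + w) ∂stdGaussian ∂ν := by
    rw [← integral_prod_symm _ h1', ← hmap, integral_map hT.aemeasurable
      (by rw [hmap]; exact h1'.aestronglyMeasurable)]
    congr 1; ext x; simp
  rw [h1'', key2 _ h2]
  apply integral_congr_ae
  filter_upwards [(integrable_prod_iff' (key F h0).aestronglyMeasurable).1 (key F h0) |>.1,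
    (integrable_prod_iff' h1'.aestronglyMeasurable).1 h1' |>.1,
    (integrable_prod_iff' (key _ h2).aestronglyMeasurable).1 (key _ h2) |>.1] with w a b c
  refine integral_mul_stdGaussian (fun s => ?_) a b c
  have hd : HasDerivAt (fun s : ℝ => s • Γ i + w) (Γ i) s := by
    simpa using ((hasDerivAt_id s).smul_const (Γ i)).add_const w
  exact (hF _).comp_hasDerivAt s hd

end IsUnitGaussian

end UnitGaussian

/-! ### Interpolation along a rotation -/

section Interpolation

variable {ι : Type*} [Fintype ι]

/-- `Φ` is a bounded function on `ℝ^ι` of class `C¹` whose partial derivatives are the bounded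
functions `dΦ j`. -/
structure HasBddGradient (Φ : (ι → ℝ) → ℝ) (dΦ : ι → (ι → ℝ) → ℝ) : Prop where
  bdd : ∃ M, ∀ x, |Φ x| ≤ M
  hasFDerivAt : ∀ x, HasFDerivAt Φ
    (∑ j, dΦ j x • (ContinuousLinearMap.proj j : (ι → ℝ) →L[ℝ] ℝ)) x
  cont : ∀ j, Continuous (dΦ j)
  bdd_grad : ∃ M, ∀ j x, |dΦ j x| ≤ M

lemma HasBddGradient.continuous {Φ : (ι → ℝ) → ℝ} {dΦ : ι → (ι → ℝ) → ℝ}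
    (h : HasBddGradient Φ dΦ) : Continuous Φ :=
  continuous_iff_continuousAt.2 fun x => (h.hasFDerivAt x).continuousAt

lemma integrable_of_continuous_of_bdd {α : Type*} [TopologicalSpace α] [MeasurableSpace α]
    [OpensMeasurableSpace α] {μ : Measure α} [IsFiniteMeasure μ]
    {f : α → ℝ} (hf : Continuous f) {M : ℝ} (hM : ∀ x, |f x| ≤ M) : Integrable f μ :=
  Integrable.of_bound hf.measurable.aestronglyMeasurable M (ae_of_all _ hM)

variable {μ : Measure (ι → ℝ)} {Γ : ι → ι → ℝ} {Φ Ψ : (ι → ℝ) → ℝ} {dΦ dΨ : ι → (ι → ℝ) → ℝ}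

/-- The product of a centered Gaussian law with itself is invariant under rotations. -/
lemma IsUnitGaussian.integral_rotation (hμ : IsUnitGaussian μ Γ) (t : ℝ)
    {G : (ι → ℝ) × (ι → ℝ) → ℝ} (hG : Continuous G) :
    ∫ p, G (Real.cos t • p.1 + Real.sin t • p.2, - Real.sin t • p.1 + Real.cos t • p.2)
      ∂(μ.prod μ) = ∫ p, G p ∂(μ.prod μ) := by
  have := hμ.gaussian
  have h0 : μ[id] = 0 := by
    ext i
    rw [Pi.zero_apply, ← hμ.mean i]
    exact ((ContinuousLinearMap.proj i : (ι → ℝ) →L[ℝ] ℝ).integral_comp_comm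
      IsGaussian.integrable_id).symm
  conv_rhs => rw [← IsGaussian.map_rotation_eq_self h0 t]
  rw [integral_map (by fun_prop) hG.measurable.aestronglyMeasurable]
  simp only [ContinuousLinearMap.rotation_apply]

lemma IsUnitGaussian.integral_rotation_fst (hμ : IsUnitGaussian μ Γ) (t : ℝ)
    {G : (ι → ℝ) × (ι → ℝ) → ℝ} (hG : Continuous G) :
    ∫ p, G (p.1, Real.cos t • p.1 + Real.sin t • p.2) ∂(μ.prod μ) =
      ∫ p, G (Real.cos t • p.1 - Real.sin t • p.2, p.1) ∂(μ.prod μ) := by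
  rw [← hμ.integral_rotation t (G := fun p => G (Real.cos t • p.1 - Real.sin t • p.2, p.1))
    (by fun_prop)]
  congr 1
  ext p
  congr 2
  ext i
  simp
  linear_combination (-p.1 i) * Real.sin_sq_add_cos_sq t

/-- After a rotation, `p.1` becomes `cos t • x - sin t • y` and `- sin t • p.1 + cos t • p.2`
becomes `y`, so that integration by parts in `y` applies. -/
lemma IsUnitGaussian.integral_mul_deriv_rotation (hμ : IsUnitGaussian μ Γ)
    (hΦ : HasBddGradient Φ dΦ) {D : (ι → ℝ) → ℝ} (hD : Continuous D) {M : ℝ}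
    (hM : ∀ x, |D x| ≤ M) (k : ι) (t : ℝ) :
    ∫ p, Φ p.1 * (D (Real.cos t • p.1 + Real.sin t • p.2) *
        (- Real.sin t * p.1 k + Real.cos t * p.2 k)) ∂(μ.prod μ) =
      - Real.sin t * ∫ p, ∑ j, Γ j k * (dΦ j p.1 * D (Real.cos t • p.1 + Real.sin t • p.2))
        ∂(μ.prod μ) := by
  have := hμ.isProbabilityMeasure
  have hΦc := hΦ.continuous
  have hdc := hΦ.cont
  obtain ⟨M0, hM0⟩ := hΦ.bdd
  obtain ⟨M1, hM1⟩ := hΦ.bdd_grad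
  have hy : Integrable (fun p : (ι → ℝ) × (ι → ℝ) => p.2 k) (μ.prod μ) :=
    (hμ.integrable_eval k).comp_snd μ
  have hL : ∫ p, Φ p.1 * (D (Real.cos t • p.1 + Real.sin t • p.2) *
        (- Real.sin t * p.1 k + Real.cos t * p.2 k)) ∂(μ.prod μ) =
      ∫ p, D p.1 * (p.2 k * Φ (Real.cos t • p.1 - Real.sin t • p.2)) ∂(μ.prod μ) := by
    rw [← hμ.integral_rotation t
      (G := fun p => D p.1 * (p.2 k * Φ (Real.cos t • p.1 - Real.sin t • p.2))) (by fun_prop)]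
    congr 1
    ext p
    have : Real.cos t • (Real.cos t • p.1 + Real.sin t • p.2) -
        Real.sin t • (- Real.sin t • p.1 + Real.cos t • p.2) = p.1 := by
      ext i
      simp
      linear_combination (p.1 i) * Real.sin_sq_add_cos_sq t
    simp only [this]
    simp
    ring
  have hR : ∫ p, ∑ j, Γ j k * (dΦ j p.1 * D (Real.cos t • p.1 + Real.sin t • p.2)) ∂(μ.prod μ) =
      ∫ p, D p.1 * ∑ j, Γ j k * dΦ j (Real.cos t • p.1 - Real.sin t • p.2) ∂(μ.prod μ) := by
    rw [hμ.integral_rotation_fst t (G := fun p => ∑ j, Γ j k * (dΦ j p.1 * D p.2)) (by fun_prop)]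
    congr 1
    ext p
    rw [Finset.mul_sum]
    exact Finset.sum_congr rfl fun j _ => by ring
  have hbd : ∀ x : ι → ℝ, |∑ j, Γ j k * dΦ j x| ≤ ∑ j, |Γ j k| * M1 := fun x =>
    (Finset.abs_sum_le_sum_abs _ _).trans (Finset.sum_le_sum fun j _ => by
      rw [abs_mul]; exact mul_le_mul_of_nonneg_left (hM1 j x) (abs_nonneg _))
  rw [hL, hR, integral_prod, integral_prod, ← integral_const_mul]
  · congr 1
    ext x
    simp only
    rw [integral_const_mul, integral_const_mul, mul_left_comm]
    congr 1
    have hd : ∀ y, HasFDerivAt (fun y => Φ (Real.cos t • x - Real.sin t • y))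
        (-Real.sin t • ∑ j, dΦ j (Real.cos t • x - Real.sin t • y) •
          (ContinuousLinearMap.proj j : (ι → ℝ) →L[ℝ] ℝ)) y := by
      intro y
      have h1 : HasFDerivAt (fun y : ι → ℝ => Real.cos t • x - Real.sin t • y)
          (-(Real.sin t • ContinuousLinearMap.id ℝ (ι → ℝ))) y :=
        ((hasFDerivAt_id y).const_smul (Real.sin t)).const_sub _
      have h2 := (hΦ.hasFDerivAt (Real.cos t • x - Real.sin t • y)).comp y h1
      refine h2.congr_fderiv ?_
      ext z
      simp
    have hcalc : ∀ y : ι → ℝ, (-Real.sin t • ∑ j, dΦ j (Real.cos t • x - Real.sin t • y) •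
          (ContinuousLinearMap.proj j : (ι → ℝ) →L[ℝ] ℝ)) (Γ k) =
        - Real.sin t * ∑ j, Γ j k * dΦ j (Real.cos t • x - Real.sin t • y) := by
      intro y
      simp [_root_.sum_apply]
      left
      exact Finset.sum_congr rfl fun j _ => by rw [hμ.symm k j, mul_comm]
    rw [hμ.integral_eval_mul k hd, ← integral_const_mul]
    · simp_rw [hcalc]
    · exact integrable_of_continuous_of_bdd (by fun_prop) fun y => hM0 _
    · exact (hμ.integrable_eval k).mul_bdd (c := M0)
        (Continuous.aestronglyMeasurable (by fun_prop)) (ae_of_all _ fun y => hM0 _)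
    · simp_rw [hcalc]
      exact (integrable_of_continuous_of_bdd (by fun_prop) fun y => hbd _).const_mul _
  · refine integrable_of_continuous_of_bdd (M := M * ∑ j, |Γ j k| * M1) (by fun_prop) fun p => ?_
    rw [abs_mul]
    exact mul_le_mul (hM _) (hbd _) (abs_nonneg _) ((abs_nonneg _).trans (hM 0))
  · refine Integrable.bdd_mul (c := M) ?_ (Continuous.aestronglyMeasurable (by fun_prop))
      (ae_of_all _ fun p => hM _)
    exact hy.mul_bdd (c := M0) (Continuous.aestronglyMeasurable (by fun_prop))
      (ae_of_all _ fun y => hM0 _)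

/-- Interpolation formula for the covariance of two functions of a Gaussian vector: the rotation
`cos t • x + sin t • y` leads from `x` at `t = 0` to its independent copy `y` at `t = π / 2`. -/
lemma IsUnitGaussian.covariance_eq_integral (hμ : IsUnitGaussian μ Γ)
    (hΦ : HasBddGradient Φ dΦ) (hΨ : HasBddGradient Ψ dΨ) :
    ∫ x, Φ x * Ψ x ∂μ - (∫ x, Φ x ∂μ) * ∫ x, Ψ x ∂μ =
      ∫ t in (0 : ℝ)..Real.pi / 2, Real.sin t * ∫ p, ∑ j, ∑ k, Γ j k *
        (dΦ j p.1 * dΨ k (Real.cos t • p.1 + Real.sin t • p.2)) ∂(μ.prod μ) := by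
  have := hμ.isProbabilityMeasure
  have hΦc := hΦ.continuous
  have hΨc := hΨ.continuous
  have hdΦ := hΦ.cont
  have hdΨ := hΨ.cont
  obtain ⟨M0, hM0⟩ := hΦ.bdd
  obtain ⟨M0', hM0'⟩ := hΨ.bdd
  obtain ⟨M1, hM1⟩ := hΦ.bdd_grad
  obtain ⟨M1', hM1'⟩ := hΨ.bdd_grad
  -- the derivative of `Φ x * Ψ (cos t • x + sin t • y)` in `t`
  let F : ℝ → (ι → ℝ) × (ι → ℝ) → ℝ := fun t p => ∑ k, Φ p.1 *
    (dΨ k (Real.cos t • p.1 + Real.sin t • p.2) * (- Real.sin t * p.1 k + Real.cos t * p.2 k))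
  have hFc : Continuous (Function.uncurry F) := by
    simp only [F, Function.uncurry_def]
    fun_prop
  have hterm : ∀ (t : ℝ) (k : ι) (p : (ι → ℝ) × (ι → ℝ)), |Φ p.1 *
      (dΨ k (Real.cos t • p.1 + Real.sin t • p.2) *
        (- Real.sin t * p.1 k + Real.cos t * p.2 k))| ≤ M0 * (M1' * (|p.1 k| + |p.2 k|)) := by
    intro t k p
    rw [abs_mul, abs_mul]
    have h3 : |(- Real.sin t * p.1 k + Real.cos t * p.2 k)| ≤ |p.1 k| + |p.2 k| := by
      refine (abs_add_le _ _).trans (add_le_add ?_ ?_) <;> rw [abs_mul]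
      · rw [abs_neg]; exact mul_le_of_le_one_left (abs_nonneg _) (Real.abs_sin_le_one t)
      · exact mul_le_of_le_one_left (abs_nonneg _) (Real.abs_cos_le_one t)
    exact mul_le_mul (hM0 _) (mul_le_mul (hM1' _ _) h3 (abs_nonneg _)
      ((abs_nonneg _).trans (hM1' k 0))) (by positivity) ((abs_nonneg _).trans (hM0 0))
  have hint1 : ∀ k, Integrable (fun p : (ι → ℝ) × (ι → ℝ) => M0 * (M1' * (|p.1 k| + |p.2 k|)))
      (μ.prod μ) := fun k =>
    ((((hμ.integrable_eval k).comp_fst μ).abs.add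
      ((hμ.integrable_eval k).comp_snd μ).abs).const_mul _).const_mul _
  have hFint : Integrable (Function.uncurry F)
      ((volume.restrict (Set.uIoc 0 (Real.pi / 2))).prod (μ.prod μ)) := by
    have : IsFiniteMeasure (volume.restrict (Set.uIoc (0:ℝ) (Real.pi / 2))) :=
      ⟨by simp [Set.uIoc]⟩
    refine Integrable.mono' (g := fun q => ∑ k, M0 * (M1' * (|q.2.1 k| + |q.2.2 k|)))
      (integrable_finsetSum _ fun k _ => (hint1 k).comp_snd _)
      hFc.measurable.aestronglyMeasurable (ae_of_all _ fun q => ?_)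
    exact (Finset.abs_sum_le_sum_abs _ _).trans (Finset.sum_le_sum fun k _ => hterm _ _ _)
  have hFTC : ∀ p : (ι → ℝ) × (ι → ℝ),
      ∫ t in (0 : ℝ)..Real.pi / 2, F t p = Φ p.1 * Ψ p.2 - Φ p.1 * Ψ p.1 := by
    intro p
    have hd : ∀ t, HasDerivAt (fun t => Φ p.1 * Ψ (Real.cos t • p.1 + Real.sin t • p.2))
        (F t p) t := by
      intro t
      have h1 : HasDerivAt (fun t => Real.cos t • p.1 + Real.sin t • p.2)
          (- Real.sin t • p.1 + Real.cos t • p.2) t :=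
        ((Real.hasDerivAt_cos t).smul_const p.1).add ((Real.hasDerivAt_sin t).smul_const p.2)
      have h2 := ((hΨ.hasFDerivAt _).comp_hasDerivAt t h1).const_mul (Φ p.1)
      refine h2.congr_deriv ?_
      simp [F, _root_.sum_apply, Finset.mul_sum]
    rw [intervalIntegral.integral_eq_sub_of_hasDerivAt (fun t _ => hd t)]
    · simp
    · exact Continuous.intervalIntegrable (by
        exact hFc.comp (continuous_id.prodMk continuous_const)) _ _
  have hswap := intervalIntegral_integral_swap hFint
  simp_rw [hFTC] at hswap
  have hb1 : Integrable (fun p : (ι → ℝ) × (ι → ℝ) => Φ p.1 * Ψ p.2) (μ.prod μ) :=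
    (integrable_of_continuous_of_bdd hΦc hM0).mul_prod (integrable_of_continuous_of_bdd hΨc hM0')
  have hb2 : Integrable (fun x => Φ x * Ψ x) μ :=
    (integrable_of_continuous_of_bdd hΨc hM0').bdd_mul (c := M0)
      hΦc.aestronglyMeasurable (ae_of_all _ fun y => hM0 _)
  rw [integral_sub hb1 (hb2.comp_fst μ), integral_prod_mul,
    integral_fun_fst (fun x => Φ x * Ψ x)] at hswap
  simp only [probReal_univ, one_smul] at hswap
  rw [← neg_sub, ← hswap, ← intervalIntegral.integral_neg]
  congr 1
  ext t
  have hS : ∀ k, Integrable (fun p : (ι → ℝ) × (ι → ℝ) => ∑ j, Γ j k *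
      (dΦ j p.1 * dΨ k (Real.cos t • p.1 + Real.sin t • p.2))) (μ.prod μ) := by
    intro k
    refine integrable_of_continuous_of_bdd (M := ∑ j, |Γ j k| * (M1 * M1')) (by fun_prop)
      fun p => (Finset.abs_sum_le_sum_abs _ _).trans (Finset.sum_le_sum fun j _ => ?_)
    rw [abs_mul, abs_mul]
    exact mul_le_mul_of_nonneg_left (mul_le_mul (hM1 _ _) (hM1' _ _) (abs_nonneg _)
      ((abs_nonneg _).trans (hM1 j 0))) (abs_nonneg _)
  simp only [F]
  rw [integral_finsetSum]
  · simp_rw [fun k => hμ.integral_mul_deriv_rotation hΦ (hdΨ k) (hM1' k) k t]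
    rw [← Finset.mul_sum, ← integral_finsetSum _ fun k _ => hS k, neg_mul, neg_neg]
    simp_rw [fun p : (ι → ℝ) × (ι → ℝ) => Finset.sum_comm (s := Finset.univ (α := ι))
      (t := Finset.univ (α := ι)) (f := fun j k => Γ j k *
        (dΦ j p.1 * dΨ k (Real.cos t • p.1 + Real.sin t • p.2)))]
  · intro k _
    refine (hint1 k).mono' (Continuous.aestronglyMeasurable (by fun_prop))
      (ae_of_all _ fun p => hterm t k p)

lemma abs_integral_sin_mul_le {J : ℝ → ℝ} {B : ℝ} (hJ : ∀ t, |J t| ≤ B) :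
    |∫ t in (0 : ℝ)..Real.pi / 2, Real.sin t * J t| ≤ B := by
  have h : ‖∫ t in (0 : ℝ)..Real.pi / 2, Real.sin t * J t‖ ≤
      ∫ t in (0 : ℝ)..Real.pi / 2, B * Real.sin t := by
    refine intervalIntegral.norm_integral_le_of_norm_le (by linarith [Real.pi_pos])
      (ae_of_all _ fun t ht => ?_)
      ((continuous_const.mul Real.continuous_sin).intervalIntegrable (μ := volume) _ _)
    have hs : 0 ≤ Real.sin t := Real.sin_nonneg_of_nonneg_of_le_pi ht.1.le
      (ht.2.trans (by linarith [Real.pi_pos]))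
    rw [Real.norm_eq_abs, abs_mul, abs_of_nonneg hs, mul_comm]
    exact mul_le_mul_of_nonneg_right (hJ t) hs
  simpa using h

end Interpolation

/-! ### Variance of the interpolated Stein kernel -/

section Kernel

variable {ι : Type*} {μ : Measure (ι → ℝ)} {Γ : ι → ι → ℝ}

lemma IsUnitGaussian.integral_comp_eval (hμ : IsUnitGaussian μ Γ) {f : ℝ → ℝ} (hf : Continuous f)
    (i : ι) : ∫ x, f (x i) ∂μ = ∫ s, f s ∂stdGaussian := by
  rw [← hμ.map_eval i, integral_map (measurable_pi_apply i).aemeasurable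
    hf.aestronglyMeasurable]

variable [Fintype ι]

/-- Covariance matrix of `(x, cos t • x + sin t • y)` when `x, y` are independent with covariance
matrix `Γ`. -/
def coupledCov (Γ : ι → ι → ℝ) (t : ℝ) : ι ⊕ ι → ι ⊕ ι → ℝ
  | .inl i, .inl j => Γ i j
  | .inl i, .inr j => Real.cos t * Γ i j
  | .inr i, .inl j => Real.cos t * Γ i j
  | .inr i, .inr j => Γ i j

lemma IsUnitGaussian.coupled (hμ : IsUnitGaussian μ Γ) (t : ℝ) :
    IsUnitGaussian ((μ.prod μ).map fun p => Sum.elim p.1 (Real.cos t • p.1 + Real.sin t • p.2))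
      (coupledCov Γ t) := by
  have := hμ.gaussian
  let L : ((ι → ℝ) × (ι → ℝ)) →L[ℝ] (ι ⊕ ι → ℝ) :=
    ContinuousLinearMap.pi (Sum.elim
      (fun i => (ContinuousLinearMap.proj i : (ι → ℝ) →L[ℝ] ℝ) ∘L
        ContinuousLinearMap.fst ℝ (ι → ℝ) (ι → ℝ))
      (fun i => (ContinuousLinearMap.proj i : (ι → ℝ) →L[ℝ] ℝ) ∘L
        (Real.cos t • ContinuousLinearMap.fst ℝ (ι → ℝ) (ι → ℝ) +
          Real.sin t • ContinuousLinearMap.snd ℝ (ι → ℝ) (ι → ℝ))))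
  have hL : (fun p : (ι → ℝ) × (ι → ℝ) => Sum.elim p.1 (Real.cos t • p.1 + Real.sin t • p.2)) =
      L := by
    ext p (i | i) <;> simp [L]
  have hev : ∀ a : ι ⊕ ι, AEStronglyMeasurable (fun w : ι ⊕ ι → ℝ => w a)
      ((μ.prod μ).map L) := fun a => (measurable_pi_apply a).aestronglyMeasurable
  have hev2 : ∀ a b : ι ⊕ ι, AEStronglyMeasurable (fun w : ι ⊕ ι → ℝ => w a * w b)
      ((μ.prod μ).map L) := fun a b => (hev a).mul (hev b)
  have hmul : ∀ i j, Integrable (fun x : ι → ℝ => x i * x j) μ := fun i j =>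
    (hμ.memLp_eval i 2 (by simp)).integrable_mul (hμ.memLp_eval j 2 (by simp))
  have hfst : ∀ i j, ∫ p, p.1 i * p.1 j ∂(μ.prod μ) = Γ i j := fun i j => by
    rw [integral_fun_fst (fun x : ι → ℝ => x i * x j), hμ.cov]; simp
  have hcross : ∀ i j, ∫ p, p.1 i * (Real.cos t * p.1 j + Real.sin t * p.2 j) ∂(μ.prod μ) =
      Real.cos t * Γ i j := fun i j => by
    have h1 : Integrable (fun p : (ι → ℝ) × (ι → ℝ) => Real.cos t * (p.1 i * p.1 j))
        (μ.prod μ) := ((hmul i j).comp_fst μ).const_mul _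
    have h2 : Integrable (fun p : (ι → ℝ) × (ι → ℝ) => Real.sin t * (p.1 i * p.2 j))
        (μ.prod μ) := ((hμ.integrable_eval i).mul_prod (hμ.integrable_eval j)).const_mul _
    have e : (fun p : (ι → ℝ) × (ι → ℝ) => p.1 i * (Real.cos t * p.1 j + Real.sin t * p.2 j)) =
        fun p => Real.cos t * (p.1 i * p.1 j) + Real.sin t * (p.1 i * p.2 j) := by
      ext p; ring
    rw [e, integral_add h1 h2, integral_const_mul, integral_const_mul, hfst,
      integral_prod_mul (fun x : ι → ℝ => x i) (fun x : ι → ℝ => x j), hμ.mean]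
    ring
  rw [hL]
  refine ⟨inferInstance, fun a => ?_, fun a b => ?_, fun a => ?_⟩
  · rw [integral_map L.continuous.aemeasurable (hev a), ← hL]
    rcases a with i | i
    · simp only [Sum.elim_inl]
      rw [integral_fun_fst (fun x : ι → ℝ => x i), hμ.mean]; simp
    · simp only [Sum.elim_inr]
      rw [hμ.integral_rotation t (G := fun p => p.1 i) (by fun_prop),
        integral_fun_fst (fun x : ι → ℝ => x i), hμ.mean]; simp
  · rw [integral_map L.continuous.aemeasurable (hev2 a b), ← hL]
    rcases a with i | i <;> rcases b with j | j <;>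
      simp only [Sum.elim_inl, Sum.elim_inr, coupledCov]
    · exact hfst i j
    · exact hcross i j
    · rw [hμ.symm, ← hcross j i]
      congr 1; ext p; simp; ring
    · rw [hμ.integral_rotation t (G := fun p => p.1 i * p.1 j) (by fun_prop), hfst]
  · rcases a with i | i <;> simp [coupledCov, hμ.unit]

lemma sum_abs_coupledCov_le {R : ℝ} (hR : ∀ i, ∑ j, |Γ i j| ≤ R) (t : ℝ) :
    ∑ a, ∑ b, |coupledCov Γ t a b| ≤ 4 * Fintype.card ι * R := by
  have hle : ∀ i j, |Real.cos t * Γ i j| ≤ |Γ i j| := fun i j => by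
    rw [abs_mul]; exact mul_le_of_le_one_left (abs_nonneg _) (Real.abs_cos_le_one t)
  have hrow : ∀ a, ∑ b, |coupledCov Γ t a b| ≤ 2 * R := by
    rintro (i | i) <;> rw [Fintype.sum_sum_type] <;> simp only [coupledCov]
    · linarith [hR i, Finset.sum_le_sum fun j (_ : j ∈ Finset.univ) => hle i j]
    · linarith [hR i, Finset.sum_le_sum fun j (_ : j ∈ Finset.univ) => hle i j]
  refine (Finset.sum_le_sum fun a _ => hrow a).trans (le_of_eq ?_)
  simp
  ring

/-- A weak form of Hölder's inequality for four functions. -/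
lemma abs_integral_mul_four_le {α : Type*} [MeasurableSpace α] {ν : Measure α} {A : ℝ}
    {f : Fin 4 → α → ℝ} (hf : ∀ i, Integrable (fun x => f i x ^ 4) ν)
    (hA : ∀ i, ∫ x, f i x ^ 4 ∂ν ≤ A) :
    |∫ x, f 0 x * f 1 x * (f 2 x * f 3 x) ∂ν| ≤ A := by
  have hpt : ∀ x, ‖f 0 x * f 1 x * (f 2 x * f 3 x)‖ ≤
      (f 0 x ^ 4 + f 1 x ^ 4 + f 2 x ^ 4 + f 3 x ^ 4) / 4 := by
    intro x
    rw [Real.norm_eq_abs, abs_le]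
    constructor <;>
    nlinarith [sq_nonneg (f 0 x * f 1 x + f 2 x * f 3 x), sq_nonneg (f 0 x * f 1 x - f 2 x * f 3 x),
      sq_nonneg (f 0 x ^ 2 - f 1 x ^ 2), sq_nonneg (f 2 x ^ 2 - f 3 x ^ 2)]
  have h01 : Integrable (fun x => f 0 x ^ 4 + f 1 x ^ 4) ν := (hf 0).add (hf 1)
  have h012 : Integrable (fun x => f 0 x ^ 4 + f 1 x ^ 4 + f 2 x ^ 4) ν := h01.add (hf 2)
  have hint : Integrable (fun x => (f 0 x ^ 4 + f 1 x ^ 4 + f 2 x ^ 4 + f 3 x ^ 4) / 4) ν :=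
    (h012.add (hf 3)).div_const 4
  refine (norm_integral_le_of_norm_le hint (ae_of_all _ hpt)).trans ?_
  rw [integral_div, integral_add h012 (hf 3), integral_add h01 (hf 2), integral_add (hf 0) (hf 1)]
  linarith [hA 0, hA 1, hA 2, hA 3]

/-- `∑_{j,k} Γ_{jk} u(x_j) u(x'_k)` as a function of the concatenation of `x` and `x'`. With
`u = g'` and `x' = cos t • x + sin t • y`, its mean against `sin t dt` over `[0, π / 2]` is a Stein
kernel of `∑ i, g (x i)`. -/
def kernelFun (Γ : ι → ι → ℝ) (u : ℝ → ℝ) (w : ι ⊕ ι → ℝ) : ℝ :=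
  ∑ j, ∑ k, Γ j k * (u (w (.inl j)) * u (w (.inr k)))

/-- The copy of `k` in the half of `ι ⊕ ι` that does not contain `a`. -/
def opp (a : ι ⊕ ι) (k : ι) : ι ⊕ ι := a.elim (fun _ => .inr k) (fun _ => .inl k)

/-- The partial derivatives of `kernelFun Γ u`, with `u'` the derivative of `u`. -/
def kernelGrad (Γ : ι → ι → ℝ) (u u' : ℝ → ℝ) (a : ι ⊕ ι) (w : ι ⊕ ι → ℝ) : ℝ :=
  ∑ k, Γ (a.elim id id) k * (u' (w a) * u (w (opp a k)))

/-- `u` is a bounded function on the line of class `C¹`, with bounded derivative `u'`. -/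
structure HasBddDeriv (u u' : ℝ → ℝ) : Prop where
  bdd : ∃ M, ∀ x, |u x| ≤ M
  hasDerivAt : ∀ x, HasDerivAt u (u' x) x
  cont : Continuous u'
  bdd_deriv : ∃ M, ∀ x, |u' x| ≤ M

lemma HasBddDeriv.continuous {u u' : ℝ → ℝ} (h : HasBddDeriv u u') : Continuous u :=
  continuous_iff_continuousAt.2 fun x => (h.hasDerivAt x).continuousAt

lemma hasFDerivAt_comp_eval {κ : Type*} [Fintype κ] {u : ℝ → ℝ} {d : ℝ} {a : κ} {w : κ → ℝ}
    (h : HasDerivAt u d (w a)) : HasFDerivAt (fun w : κ → ℝ => u (w a))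
      (d • (ContinuousLinearMap.proj a : (κ → ℝ) →L[ℝ] ℝ)) w :=
  h.comp_hasFDerivAt w (ContinuousLinearMap.proj a : (κ → ℝ) →L[ℝ] ℝ).hasFDerivAt

lemma abs_sum_mul_le {κ : Type*} (s : Finset κ) (c f : κ → ℝ) {M : ℝ} (h : ∀ k ∈ s, |f k| ≤ M) :
    |∑ k ∈ s, c k * f k| ≤ (∑ k ∈ s, |c k|) * M := by
  rw [Finset.sum_mul]
  refine (Finset.abs_sum_le_sum_abs _ _).trans (Finset.sum_le_sum fun k hk => ?_)
  rw [abs_mul]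
  exact mul_le_mul_of_nonneg_left (h k hk) (abs_nonneg _)

lemma hasBddGradient_kernelFun (hΓ : ∀ i j, Γ i j = Γ j i) {u u' : ℝ → ℝ} (hu : HasBddDeriv u u') :
    HasBddGradient (kernelFun Γ u) (kernelGrad Γ u u') := by
  obtain ⟨M, hM⟩ := hu.bdd
  obtain ⟨M', hM'⟩ := hu.bdd_deriv
  have hc := hu.continuous
  have hc' := hu.cont
  have hM0 := (abs_nonneg _).trans (hM 0)
  have hM0' := (abs_nonneg _).trans (hM' 0)
  refine ⟨⟨∑ j, (∑ k, |Γ j k|) * (M * M), fun w => ?_⟩, fun w => ?_, fun a => ?_,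
    ⟨∑ i, (∑ k, |Γ i k|) * (M' * M), fun a w => ?_⟩⟩
  · refine (Finset.abs_sum_le_sum_abs _ _).trans (Finset.sum_le_sum fun j _ => ?_)
    refine abs_sum_mul_le _ _ _ fun k _ => ?_
    rw [abs_mul]
    exact mul_le_mul (hM _) (hM _) (abs_nonneg _) hM0
  · have h : HasFDerivAt (kernelFun Γ u) (∑ j, ∑ k, Γ j k • (u (w (.inl j)) •
        (u' (w (.inr k)) • (ContinuousLinearMap.proj (.inr k) : (ι ⊕ ι → ℝ) →L[ℝ] ℝ)) +
        u (w (.inr k)) •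
        (u' (w (.inl j)) • (ContinuousLinearMap.proj (.inl j) : (ι ⊕ ι → ℝ) →L[ℝ] ℝ)))) w :=
      HasFDerivAt.fun_sum fun j _ => HasFDerivAt.fun_sum fun k _ =>
        ((hasFDerivAt_comp_eval (a := Sum.inl j) (hu.hasDerivAt _)).mul
          (hasFDerivAt_comp_eval (a := Sum.inr k) (hu.hasDerivAt _))).const_mul _
    refine h.congr_fderiv ?_
    ext z
    simp only [_root_.sum_apply, _root_.add_apply, _root_.smul_apply, smul_eq_mul,
      ContinuousLinearMap.proj_apply, Fintype.sum_sum_type, kernelGrad, opp, Sum.elim_inl,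
      Sum.elim_inr, id, mul_add, Finset.sum_add_distrib, Finset.sum_mul]
    rw [add_comm]
    congr 1
    · refine Finset.sum_congr rfl fun j _ => Finset.sum_congr rfl fun k _ => by ring
    · rw [Finset.sum_comm]
      refine Finset.sum_congr rfl fun j _ => Finset.sum_congr rfl fun k _ => ?_
      rw [hΓ]; ring
  · unfold kernelGrad
    fun_prop
  · refine (abs_sum_mul_le (M := M' * M) _ _ _ fun k _ => ?_).trans ?_
    · rw [abs_mul]
      exact mul_le_mul (hM' _) (hM _) (abs_nonneg _) hM0'
    · exact Finset.single_le_sum (f := fun i => (∑ k, |Γ i k|) * (M' * M))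
        (fun i _ => by positivity) (Finset.mem_univ (a.elim id id))

/-- Second order Poincaré inequality: the variance of the interpolated Stein kernel grows at most
linearly in the number of variables. It comes from the interpolation formula for the doubled vector
`(x, cos t • x + sin t • y)`; each of the three factors `R` pays for one of the free summations over
the four indices. -/
lemma IsUnitGaussian.variance_kernel_le (hμ : IsUnitGaussian μ Γ) {u u' : ℝ → ℝ}
    (hu : HasBddDeriv u u') {R A : ℝ} (hR : ∀ i, ∑ j, |Γ i j| ≤ R)
    (hA : ∫ s, u s ^ 4 ∂stdGaussian ≤ A) (hA' : ∫ s, u' s ^ 4 ∂stdGaussian ≤ A) (t : ℝ) :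
    ∫ p, (kernelFun Γ u (Sum.elim p.1 (Real.cos t • p.1 + Real.sin t • p.2))) ^ 2 ∂(μ.prod μ) -
      (∫ p, kernelFun Γ u (Sum.elim p.1 (Real.cos t • p.1 + Real.sin t • p.2)) ∂(μ.prod μ)) ^ 2 ≤
      4 * A * R ^ 3 * Fintype.card ι := by
  have hν := hμ.coupled t
  set ν := (μ.prod μ).map fun p => Sum.elim p.1 (Real.cos t • p.1 + Real.sin t • p.2) with hνdef
  have := hμ.isProbabilityMeasure
  have hνp := hν.isProbabilityMeasure
  have hT := hasBddGradient_kernelFun hμ.symm hu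
  obtain ⟨M, hM⟩ := hu.bdd
  obtain ⟨M', hM'⟩ := hu.bdd_deriv
  have hc := hu.continuous
  have hc' := hu.cont
  have hmap : Measurable fun p : (ι → ℝ) × (ι → ℝ) =>
      Sum.elim p.1 (Real.cos t • p.1 + Real.sin t • p.2) := by
    refine measurable_pi_iff.2 ?_
    rintro (i | i) <;> simp only [Sum.elim_inl, Sum.elim_inr] <;> fun_prop
  have hA0 : 0 ≤ A := (integral_nonneg fun s => by positivity).trans hA
  have hvar : ∫ w, kernelFun Γ u w * kernelFun Γ u w ∂ν -
      (∫ w, kernelFun Γ u w ∂ν) * ∫ w, kernelFun Γ u w ∂ν ≤ 4 * A * R ^ 3 * Fintype.card ι := by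
    rw [hν.covariance_eq_integral hT hT]
    refine (le_abs_self _).trans (abs_integral_sin_mul_le fun r => ?_)
    -- expand the two gradients and estimate each of the fourfold products by the
    -- arithmetic-geometric mean inequality
    have hexp : ∀ p : (ι ⊕ ι → ℝ) × (ι ⊕ ι → ℝ), ∑ a, ∑ b, coupledCov Γ t a b *
        (kernelGrad Γ u u' a p.1 * kernelGrad Γ u u' b (Real.cos r • p.1 + Real.sin r • p.2)) =
        ∑ q : ((ι ⊕ ι) × (ι ⊕ ι)) × (ι × ι), coupledCov Γ t q.1.1 q.1.2 *
          (Γ (q.1.1.elim id id) q.2.1 * Γ (q.1.2.elim id id) q.2.2) *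
          (u' (p.1 q.1.1) * u (p.1 (opp q.1.1 q.2.1)) *
            (u' ((Real.cos r • p.1 + Real.sin r • p.2) q.1.2) *
              u ((Real.cos r • p.1 + Real.sin r • p.2) (opp q.1.2 q.2.2)))) := by
      intro p
      rw [Fintype.sum_prod_type, Fintype.sum_prod_type]
      refine Finset.sum_congr rfl fun a _ => Finset.sum_congr rfl fun b _ => ?_
      rw [kernelGrad, kernelGrad, Finset.sum_mul_sum, Fintype.sum_prod_type, Finset.mul_sum]
      refine Finset.sum_congr rfl fun k _ => ?_
      rw [Finset.mul_sum]
      refine Finset.sum_congr rfl fun l _ => by ring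
    simp_rw [hexp]
    have hi4 : ∀ {f : ℝ → ℝ} {K : ℝ}, Continuous f → (∀ x, |f x| ≤ K) →
        ∀ h : (ι ⊕ ι → ℝ) × (ι ⊕ ι → ℝ) → ℝ, Continuous h →
        Integrable (fun p => f (h p) ^ 4) (ν.prod ν) := by
      intro f K hf hK h hh
      refine integrable_of_continuous_of_bdd (M := K ^ 4) (by fun_prop) fun p => ?_
      rw [abs_pow]
      exact pow_le_pow_left₀ (abs_nonneg _) (hK _) 4
    have hfst : ∀ {f : ℝ → ℝ}, Continuous f → ∀ a,
        ∫ p, f (p.1 a) ^ 4 ∂(ν.prod ν) = ∫ s, f s ^ 4 ∂stdGaussian := by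
      intro f hf a
      rw [integral_fun_fst (fun w : ι ⊕ ι → ℝ => f (w a) ^ 4),
        hν.integral_comp_eval (f := fun s => f s ^ 4) (by fun_prop)]
      simp
    have hrot : ∀ {f : ℝ → ℝ}, Continuous f → ∀ a,
        ∫ p, f ((Real.cos r • p.1 + Real.sin r • p.2) a) ^ 4 ∂(ν.prod ν) =
          ∫ s, f s ^ 4 ∂stdGaussian := by
      intro f hf a
      rw [hν.integral_rotation r (G := fun p => f (p.1 a) ^ 4) (by fun_prop), hfst hf]
    have h4 : ∀ a a' b b' : ι ⊕ ι, |∫ p, (u' (p.1 a) * u (p.1 a') *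
            (u' ((Real.cos r • p.1 + Real.sin r • p.2) b) *
              u ((Real.cos r • p.1 + Real.sin r • p.2) b'))) ∂(ν.prod ν)| ≤ A := by
      intro a a' b b'
      refine abs_integral_mul_four_le (ν := ν.prod ν) (f := ![fun p => u' (p.1 a),
        fun p => u (p.1 a'), fun p => u' ((Real.cos r • p.1 + Real.sin r • p.2) b),
        fun p => u ((Real.cos r • p.1 + Real.sin r • p.2) b')]) ?_ ?_
      · intro i
        fin_cases i
        · exact hi4 hc' hM' (fun p => p.1 a) (by fun_prop)
        · exact hi4 hc hM (fun p => p.1 a') (by fun_prop)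
        · exact hi4 hc' hM' (fun p => (Real.cos r • p.1 + Real.sin r • p.2) b) (by fun_prop)
        · exact hi4 hc hM (fun p => (Real.cos r • p.1 + Real.sin r • p.2) b') (by fun_prop)
      · intro i
        fin_cases i
        · exact (hfst hc' a).trans_le hA'
        · exact (hfst hc a').trans_le hA
        · exact (hrot hc' b).trans_le hA'
        · exact (hrot hc b').trans_le hA
    have hint : ∀ a a' b b' : ι ⊕ ι, Integrable (fun p => (u' (p.1 a) * u (p.1 a') *
            (u' ((Real.cos r • p.1 + Real.sin r • p.2) b) *
              u ((Real.cos r • p.1 + Real.sin r • p.2) b')))) (ν.prod ν) := by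
      intro a a' b b'
      refine integrable_of_continuous_of_bdd (M := M' * M * (M' * M)) (by fun_prop) fun p => ?_
      rw [abs_mul, abs_mul, abs_mul]
      have h0 := (abs_nonneg _).trans (hM 0)
      have h0' := (abs_nonneg _).trans (hM' 0)
      gcongr <;> first | exact hM' _ | exact hM _
    rw [integral_finsetSum _ fun q _ => (hint _ _ _ _).const_mul _]
    simp_rw [integral_const_mul]
    refine (abs_sum_mul_le _ _ _ fun q _ => h4 _ _ _ _).trans ?_
    have hsum : ∑ q : ((ι ⊕ ι) × (ι ⊕ ι)) × (ι × ι), |coupledCov Γ t q.1.1 q.1.2 *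
          (Γ (q.1.1.elim id id) q.2.1 * Γ (q.1.2.elim id id) q.2.2)| ≤
        (4 * Fintype.card ι * R) * (R * R) := by
      rw [Fintype.sum_prod_type, Fintype.sum_prod_type]
      have hrow : ∀ a b : ι ⊕ ι, ∑ q : ι × ι, |coupledCov Γ t a b *
          (Γ (a.elim id id) q.1 * Γ (b.elim id id) q.2)| ≤ |coupledCov Γ t a b| * (R * R) := by
        intro a b
        simp_rw [abs_mul, ← Finset.mul_sum]
        refine mul_le_mul_of_nonneg_left ?_ (abs_nonneg _)
        rw [Fintype.sum_prod_type]
        simp only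
        rw [← Finset.sum_mul_sum]
        exact mul_le_mul (hR _) (hR _) (Finset.sum_nonneg fun _ _ => abs_nonneg _)
          ((Finset.sum_nonneg fun _ _ => abs_nonneg _).trans (hR (a.elim id id)))
      refine (Finset.sum_le_sum fun a _ => Finset.sum_le_sum fun b _ => hrow a b).trans ?_
      simp_rw [← Finset.sum_mul]
      exact mul_le_mul_of_nonneg_right (sum_abs_coupledCov_le hR t) (mul_self_nonneg R)
    calc _ ≤ (4 * Fintype.card ι * R) * (R * R) * A := mul_le_mul_of_nonneg_right hsum hA0
      _ = _ := by ring
  have hTc := hT.continuous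
  rw [hνdef, integral_map hmap.aemeasurable hTc.aestronglyMeasurable,
    integral_map (f := fun w => kernelFun Γ u w * kernelFun Γ u w) hmap.aemeasurable
      (hTc.mul hTc).aestronglyMeasurable] at hvar
  simpa only [sq] using hvar

end Kernel

/-! ### Stein's equation and the total variation distance -/

section Stein

lemma integrable_id_mul_gaussianPDFReal : Integrable fun x : ℝ => x * gaussianPDFReal 0 1 x := by
  have h : Integrable (fun x : ℝ => x) stdGaussian := by
    exact (memLp_id_gaussianReal (μ := 0) (v := 1) 1).integrable (by simp)
  simpa [mul_comm] using integrable_stdGaussian_iff.1 h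

lemma tendsto_gaussianPDFReal_atTop : Tendsto (gaussianPDFReal 0 1) atTop (𝓝 0) := by
  refine tendsto_zero_of_hasDerivAt_of_integrableOn_Ioi (a := 0)
    (fun x _ => hasDerivAt_gaussianPDFReal x) ?_ (integrable_gaussianPDFReal 0 1).integrableOn
  simpa using integrable_id_mul_gaussianPDFReal.neg.integrableOn

lemma tendsto_gaussianPDFReal_atBot : Tendsto (gaussianPDFReal 0 1) atBot (𝓝 0) := by
  refine tendsto_zero_of_hasDerivAt_of_integrableOn_Iic (a := 0)
    (fun x _ => hasDerivAt_gaussianPDFReal x) ?_ (integrable_gaussianPDFReal 0 1).integrableOn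
  simpa using integrable_id_mul_gaussianPDFReal.neg.integrableOn

/-- Mills' inequality. -/
lemma mul_integral_Ioi_gaussianPDFReal_le (x : ℝ) :
    x * ∫ y in Set.Ioi x, gaussianPDFReal 0 1 y ≤ gaussianPDFReal 0 1 x := by
  have h := integral_Ioi_of_hasDerivAt_of_tendsto' (a := x)
    (fun y _ => hasDerivAt_gaussianPDFReal y)
    (by simpa using integrable_id_mul_gaussianPDFReal.neg.integrableOn)
    tendsto_gaussianPDFReal_atTop
  have h2 : ∫ y in Set.Ioi x, x * gaussianPDFReal 0 1 y ≤
      ∫ y in Set.Ioi x, y * gaussianPDFReal 0 1 y :=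
    setIntegral_mono_on ((integrable_gaussianPDFReal 0 1).const_mul _).integrableOn
      integrable_id_mul_gaussianPDFReal.integrableOn measurableSet_Ioi fun y hy =>
      mul_le_mul_of_nonneg_right (le_of_lt hy) (gaussianPDFReal_nonneg _ _ _)
  simp_rw [neg_mul] at h
  rw [integral_neg] at h
  rw [integral_const_mul] at h2
  linarith

lemma neg_mul_integral_Iic_gaussianPDFReal_le (x : ℝ) :
    -x * ∫ y in Set.Iic x, gaussianPDFReal 0 1 y ≤ gaussianPDFReal 0 1 x := by
  have h := integral_Iic_of_hasDerivAt_of_tendsto' (a := x)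
    (fun y _ => hasDerivAt_gaussianPDFReal y)
    (by simpa using integrable_id_mul_gaussianPDFReal.neg.integrableOn)
    tendsto_gaussianPDFReal_atBot
  have h2 : ∫ y in Set.Iic x, -x * gaussianPDFReal 0 1 y ≤
      ∫ y in Set.Iic x, -y * gaussianPDFReal 0 1 y :=
    setIntegral_mono_on ((integrable_gaussianPDFReal 0 1).const_mul _).integrableOn
      (by simpa using integrable_id_mul_gaussianPDFReal.neg.integrableOn) measurableSet_Iic
      fun y hy => mul_le_mul_of_nonneg_right (neg_le_neg hy) (gaussianPDFReal_nonneg _ _ _)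
  rw [integral_const_mul] at h2
  linarith

/-- Stein's equation for a continuous test function with values in `[0, 1]`. The solution is
`(∫ y in Iic x, (h y - m) p y) / p x` with `p` the Gaussian density and `m` the mean of `h`; Mills'
inequality bounds `x * f x` by `1`. -/
lemma exists_stein_solution {h : ℝ → ℝ} (hc : Continuous h) (h0 : ∀ x, 0 ≤ h x)
    (h1 : ∀ x, h x ≤ 1) : ∃ f f' : ℝ → ℝ, HasBddDeriv f f' ∧ (∀ x, |f' x| ≤ 2) ∧
      ∀ x, f' x - x * f x = h x - ∫ y, h y ∂stdGaussian := by
  set p := gaussianPDFReal 0 1 with hp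
  set m := ∫ y, h y ∂stdGaussian with hm
  have hhint : Integrable h stdGaussian :=
    integrable_of_continuous_of_bdd hc (M := 1) fun x => by rw [abs_of_nonneg (h0 x)]; exact h1 x
  have hm0 : 0 ≤ m := integral_nonneg h0
  have hm1 : m ≤ 1 := by
    simpa using integral_mono hhint (integrable_const (1 : ℝ)) h1
  have hk : ∀ x, |h x - m| ≤ 1 := fun x => abs_le.2 ⟨by linarith [h0 x], by linarith [h1 x]⟩
  have hpd : ∀ x, HasDerivAt p (-x * p x) x := hasDerivAt_gaussianPDFReal
  have hpc : Continuous p := continuous_iff_continuousAt.2 fun x => (hpd x).continuousAt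
  have hp0 : ∀ x, 0 < p x := fun x => gaussianPDFReal_pos 0 1 x one_ne_zero
  have hpi : Integrable p := integrable_gaussianPDFReal 0 1
  have hqc : Continuous fun y => (h y - m) * p y := by fun_prop
  have hqi : Integrable fun y => (h y - m) * p y :=
    hpi.bdd_mul (c := 1) (by fun_prop) (ae_of_all _ hk)
  have hqle : ∀ y, ‖(h y - m) * p y‖ ≤ p y := fun y => by
    rw [norm_mul, Real.norm_of_nonneg (hp0 y).le]
    exact mul_le_of_le_one_left (hp0 y).le (hk y)
  have hq0 : ∫ y, (h y - m) * p y = 0 := by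
    have : ∫ y, (h y - m) ∂stdGaussian = 0 := by
      rw [integral_sub hhint (integrable_const _)]
      simp [hm]
    rw [integral_stdGaussian] at this
    simpa [mul_comm, hp] using this
  set q := fun x => ∫ y in Set.Iic x, (h y - m) * p y with hq
  have hqd : ∀ x, HasDerivAt q ((h x - m) * p x) x := by
    intro x
    have e : q = fun x => q 0 + ∫ y in (0 : ℝ)..x, (h y - m) * p y := by
      ext x
      rw [← intervalIntegral.integral_Iic_sub_Iic hqi.integrableOn hqi.integrableOn]
      simp [hq]
    rw [e]
    exact ((hqc.integral_hasStrictDerivAt 0 x).hasDerivAt).const_add _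
  have hqb : ∀ x, |x * q x| ≤ p x := by
    intro x
    rw [abs_mul]
    rcases le_total 0 x with hx | hx
    · have e : q x = -∫ y in Set.Ioi x, (h y - m) * p y := by
        have := intervalIntegral.integral_Iic_add_Ioi (b := x) hqi.integrableOn hqi.integrableOn
        rw [hq0] at this
        simp only [hq]
        linarith
      rw [e, abs_neg, abs_of_nonneg hx]
      refine (mul_le_mul_of_nonneg_left ?_ hx).trans (mul_integral_Ioi_gaussianPDFReal_le x)
      exact norm_integral_le_of_norm_le hpi.integrableOn (ae_of_all _ hqle)
    · rw [abs_of_nonpos hx]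
      refine (mul_le_mul_of_nonneg_left ?_ (by linarith)).trans
        (neg_mul_integral_Iic_gaussianPDFReal_le x)
      exact norm_integral_le_of_norm_le hpi.integrableOn (ae_of_all _ hqle)
  have hfd : ∀ x, HasDerivAt (fun x => q x / p x) (x * (q x / p x) + (h x - m)) x := by
    intro x
    refine ((hqd x).div (hpd x) (hp0 x).ne').congr_deriv ?_
    have := (hp0 x).ne'
    field_simp
    ring
  have hfc : Continuous fun x => q x / p x :=
    continuous_iff_continuousAt.2 fun x => (hfd x).continuousAt
  have hxf : ∀ x, |x * (q x / p x)| ≤ 1 := fun x => by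
    rw [← mul_div_assoc, abs_div, abs_of_pos (hp0 x)]
    exact div_le_one_of_le₀ (hqb x) (hp0 x).le
  have hf2 : ∀ x, |x * (q x / p x) + (h x - m)| ≤ 2 := fun x =>
    (abs_add_le _ _).trans (by linarith [hxf x, hk x])
  refine ⟨_, _, ⟨?_, hfd, by fun_prop, 2, hf2⟩, hf2, fun x => by ring⟩
  obtain ⟨M, hM⟩ := (isCompact_Icc (a := (-1 : ℝ)) (b := 1)).exists_bound_of_continuousOn
    hfc.continuousOn
  refine ⟨max M 1, fun x => ?_⟩
  by_cases hx : x ∈ Set.Icc (-1 : ℝ) 1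
  · exact (hM x hx).trans (le_max_left _ _)
  · have h1x : 1 ≤ |x| := by
      by_contra! hlt
      exact hx (abs_le.1 hlt.le)
    refine le_trans ?_ (le_max_right _ _)
    have := hxf x
    rw [abs_mul] at this
    exact (le_mul_of_one_le_left (abs_nonneg _) h1x).trans this

/-- Inequalities between measures of closed sets pass to Borel sets by inner regularity. -/
lemma measureReal_le_of_isClosed {μ ν : Measure ℝ} [IsFiniteMeasure μ] [IsFiniteMeasure ν] {ε : ℝ}
    (h : ∀ K, IsClosed K → μ.real K ≤ ν.real K + ε) {B : Set ℝ} (hB : MeasurableSet B) :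
    μ.real B ≤ ν.real B + ε := by
  refine le_of_forall_pos_le_add fun δ hδ => ?_
  obtain ⟨K, hKB, hK, hlt⟩ := hB.exists_isClosed_lt_add (measure_ne_top μ B)
    (ENNReal.ofReal_pos.2 hδ).ne'
  have h1 : μ.real B ≤ μ.real K + δ := by
    have := ENNReal.toReal_mono (by finiteness) hlt.le
    rwa [ENNReal.toReal_add (by finiteness) (by finiteness), ENNReal.toReal_ofReal hδ.le] at this
  linarith [h K hK, measureReal_mono (μ := ν) hKB]

/-- The total variation distance may be computed with continuous test functions. -/
lemma tvDist_le {μ ν : Measure ℝ} [IsProbabilityMeasure μ] [IsProbabilityMeasure ν] {ε : ℝ}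
    (h : ∀ f : ℝ → ℝ, Continuous f → (∀ x, 0 ≤ f x) → (∀ x, f x ≤ 1) →
      |∫ x, f x ∂μ - ∫ x, f x ∂ν| ≤ ε) : tvDist μ ν ≤ ε := by
  have hclosed : ∀ K, IsClosed K → |μ.real K - ν.real K| ≤ ε := by
    intro K hK
    have hlim : ∀ (ρ : Measure ℝ) [IsProbabilityMeasure ρ], Tendsto (fun n : ℕ =>
        ∫ x, ((thickenedIndicator (Nat.one_div_pos_of_nat (α := ℝ) (n := n)) K x : NNReal) : ℝ) ∂ρ)
        atTop (𝓝 (ρ.real K)) := by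
      intro ρ _
      have e : ρ.real K = ∫ x, K.indicator (fun _ => (1 : ℝ)) x ∂ρ := by
        rw [integral_indicator_const _ hK.measurableSet]; simp
      rw [e]
      refine tendsto_integral_of_dominated_convergence (fun _ => (1 : ℝ)) (fun n => ?_)
        (integrable_const _) (fun n => ae_of_all _ fun x => ?_) (ae_of_all _ fun x => ?_)
      · exact Continuous.aestronglyMeasurable (by fun_prop)
      · rw [Real.norm_of_nonneg (by positivity)]
        exact_mod_cast thickenedIndicator_le_one _ K x
      · have := tendsto_pi_nhds.1 (thickenedIndicator_tendsto_indicator_closure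
          (fun n : ℕ => Nat.one_div_pos_of_nat (α := ℝ) (n := n))
          tendsto_one_div_add_atTop_nhds_zero_nat K) x
        rw [hK.closure_eq] at this
        have h2 := (NNReal.continuous_coe.tendsto _).comp this
        have e2 : ((K.indicator (fun _ => (1 : NNReal)) x : NNReal) : ℝ) =
            K.indicator (fun _ => (1 : ℝ)) x := by
          by_cases hx : x ∈ K <;> simp [hx]
        rw [e2] at h2
        exact h2
    refine le_of_tendsto ((hlim μ).sub (hlim ν)).abs (Eventually.of_forall fun n => ?_)
    refine h _ (by fun_prop) (fun x => by positivity) fun x => ?_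
    exact_mod_cast thickenedIndicator_le_one _ K x
  have : Nonempty {B : Set ℝ // MeasurableSet B} := ⟨⟨∅, MeasurableSet.empty⟩⟩
  refine ciSup_le fun B => abs_sub_le_iff.2 ⟨?_, ?_⟩
  · have := measureReal_le_of_isClosed (μ := μ) (ν := ν) (ε := ε)
      (fun K hK => by linarith [(abs_sub_le_iff.1 (hclosed K hK)).1]) B.2
    linarith
  · have := measureReal_le_of_isClosed (μ := ν) (ν := μ) (ε := ε)
      (fun K hK => by linarith [(abs_sub_le_iff.1 (hclosed K hK)).2]) B.2
    linarith

end Stein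

/-! ### The normal approximation for smooth functions -/

section Smooth

variable {ι : Type*} [Fintype ι] {μ : Measure (ι → ℝ)} {Γ : ι → ι → ℝ}

lemma integral_abs_le_sqrt {α : Type*} [TopologicalSpace α] [MeasurableSpace α]
    [OpensMeasurableSpace α] {μ : Measure α} [IsProbabilityMeasure μ]
    {f : α → ℝ} (hf : Continuous f) {M : ℝ} (hM : ∀ x, |f x| ≤ M) :
    ∫ x, |f x| ∂μ ≤ √(∫ x, f x ^ 2 ∂μ) := by
  refine Real.le_sqrt_of_sq_le ?_
  have hL : MemLp (fun x => |f x|) 2 μ :=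
    MemLp.of_bound hf.abs.measurable.aestronglyMeasurable M (ae_of_all _ fun x => by simpa using hM x)
  have := variance_nonneg (fun x => |f x|) μ
  rw [variance_eq_sub hL] at this
  simp only [Pi.pow_apply, sq_abs] at this
  linarith

lemma hasBddGradient_comp_sum {g g' : ℝ → ℝ} (hg : HasBddDeriv g g') {f f' : ℝ → ℝ}
    (hf : ∀ s, HasDerivAt f (f' s) s) (hf' : Continuous f') {M M' : ℝ}
    (hM : ∀ x : ι → ℝ, |f (∑ i, g (x i))| ≤ M) (hM' : ∀ s, |f' s| ≤ M') :
    HasBddGradient (fun x : ι → ℝ => f (∑ i, g (x i)))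
      (fun j x => f' (∑ i, g (x i)) * g' (x j)) := by
  obtain ⟨K, hK⟩ := hg.bdd_deriv
  have hgc := hg.continuous
  have hgc' := hg.cont
  refine ⟨⟨M, hM⟩, fun x => ?_, fun j => by fun_prop, M' * K, fun j x => ?_⟩
  · have h := (hf (∑ i, g (x i))).comp_hasFDerivAt x
      (HasFDerivAt.fun_sum fun i (_ : i ∈ Finset.univ) =>
        hasFDerivAt_comp_eval (hg.hasDerivAt (x i)))
    refine h.congr_fderiv ?_
    simp_rw [Finset.smul_sum, smul_smul]
  · rw [abs_mul]
    exact mul_le_mul (hM' _) (hK _) (abs_nonneg _) ((abs_nonneg _).trans (hM' 0))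

/-- Normal approximation of `S = ∑ i, g (x i)` for smooth `g`: the interpolation formula applied to
`S` and to `a S / v - f (S / √v) / √v`, where `f` solves Stein's equation and `a` is the mean of
`f' (S / √v)`, reduces the claim to the variance of the interpolated kernel. -/
theorem IsUnitGaussian.abs_integral_sub_le (hμ : IsUnitGaussian μ Γ) {g g' g'' : ℝ → ℝ}
    (hg : HasBddDeriv g g') (hg' : HasBddDeriv g' g'') (hmean : ∫ s, g s ∂stdGaussian = 0)
    {R A v : ℝ} (hR : ∀ i, ∑ j, |Γ i j| ≤ R) (hA : ∫ s, g' s ^ 4 ∂stdGaussian ≤ A)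
    (hA' : ∫ s, g'' s ^ 4 ∂stdGaussian ≤ A) (hv : ∫ x, (∑ i, g (x i)) ^ 2 ∂μ = v) (hv0 : 0 < v)
    {h : ℝ → ℝ} (hc : Continuous h) (h0 : ∀ x, 0 ≤ h x) (h1 : ∀ x, h x ≤ 1) :
    |∫ x, h ((∑ i, g (x i)) / √v) ∂μ - ∫ s, h s ∂stdGaussian| ≤
      4 / v * √(4 * A * R ^ 3 * Fintype.card ι) := by
  have := hμ.isProbabilityMeasure
  obtain ⟨f, f', hf, hf2, hstein⟩ := exists_stein_solution hc h0 h1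
  have hs0 : 0 < √v := Real.sqrt_pos.2 hv0
  have hss : √v * √v = v := Real.mul_self_sqrt hv0.le
  obtain ⟨K, hK⟩ := hg.bdd
  obtain ⟨K', hK'⟩ := hg'.bdd
  obtain ⟨L, hL⟩ := hf.bdd
  have hgc := hg.continuous
  have hgc' := hg'.continuous
  have hfc := hf.continuous
  have hfc' := hf.cont
  set S : (ι → ℝ) → ℝ := fun x => ∑ i, g (x i) with hS
  have hSb : ∀ x, |S x| ≤ Fintype.card ι * K := fun x =>
    (Finset.abs_sum_le_sum_abs _ _).trans ((Finset.sum_le_sum fun i _ => hK (x i)).trans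
      (by simp))
  have hSm : ∫ x, S x ∂μ = 0 := by
    simp only [hS]
    rw [integral_finsetSum]
    · simp_rw [fun i => hμ.integral_comp_eval hgc i, hmean]
      simp
    · exact fun i _ => integrable_of_continuous_of_bdd (by fun_prop) fun x => hK (x i)
  set a := ∫ x, f' (S x / √v) ∂μ with ha
  have hf'i : Integrable (fun x => f' (S x / √v)) μ :=
    integrable_of_continuous_of_bdd (by fun_prop) fun x => hf2 _
  have ha2 : |a| ≤ 2 := by
    have := norm_integral_le_of_norm_le_const (μ := μ) (C := 2) (f := fun x => f' (S x / √v))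
      (ae_of_all _ fun x => hf2 _)
    simpa using this
  have hb4 : ∀ s, |a - f' (s / √v)| ≤ 4 := fun s =>
    (abs_sub _ _).trans (by linarith [hf2 (s / √v)])
  -- the two functions to which the interpolation formula is applied
  have hΨ : HasBddGradient S (fun j x => 1 * g' (x j)) :=
    hasBddGradient_comp_sum hg (f := fun s => s) (f' := fun _ => 1) (fun s => hasDerivAt_id s)
      continuous_const hSb (fun s => by simp) (M' := 1)
  have hΦ : HasBddGradient (fun x => a / v * S x - f (S x / √v) / √v)
      (fun j x => ((a - f' (S x / √v)) / v) * g' (x j)) := by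
    refine hasBddGradient_comp_sum hg (f := fun s => a / v * s - f (s / √v) / √v)
      (f' := fun s => (a - f' (s / √v)) / v) (fun s => ?_) (by fun_prop)
      (M := |a / v| * (Fintype.card ι * K) + L / √v) (fun x => ?_) (M' := 4 / v) (fun s => ?_)
    · have e1 := (hf.hasDerivAt (s / √v)).comp s ((hasDerivAt_id s).div_const (√v))
      refine (((hasDerivAt_id s).const_mul (a / v)).sub (e1.div_const (√v))).congr_deriv ?_
      rw [mul_one, mul_one_div, div_div, hss, sub_div]
    · refine (abs_sub _ _).trans (add_le_add ?_ ?_)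
      · rw [abs_mul]
        exact mul_le_mul_of_nonneg_left (hSb x) (abs_nonneg _)
      · rw [abs_div, abs_of_pos hs0]
        exact div_le_div_of_nonneg_right (hL _) hs0.le
    · rw [abs_div, abs_of_pos hv0]
      exact div_le_div_of_nonneg_right (hb4 s) hv0.le
  have hid := hμ.covariance_eq_integral hΦ hΨ
  have hlhs : ∫ x, (a / v * S x - f (S x / √v) / √v) * S x ∂μ =
      ∫ x, h (S x / √v) ∂μ - ∫ s, h s ∂stdGaussian := by
    have i1 : Integrable (fun x => a / v * S x ^ 2) μ := by
      refine (integrable_of_continuous_of_bdd (M := (Fintype.card ι * K) ^ 2) (by fun_prop)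
        fun x => ?_).const_mul _
      rw [abs_pow]
      exact pow_le_pow_left₀ (abs_nonneg _) (hSb x) 2
    have i2 : Integrable (fun x => S x / √v * f (S x / √v)) μ := by
      refine integrable_of_continuous_of_bdd (M := Fintype.card ι * K / √v * L)
        (by fun_prop) fun x => ?_
      rw [abs_mul, abs_div, abs_of_pos hs0]
      exact mul_le_mul (div_le_div_of_nonneg_right (hSb x) hs0.le) (hL _) (abs_nonneg _)
        (div_nonneg ((abs_nonneg _).trans (hSb x)) hs0.le)
    have i3 : Integrable (fun x => f' (S x / √v) - S x / √v * f (S x / √v)) μ := hf'i.sub i2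
    have e1 : (fun x => (a / v * S x - f (S x / √v) / √v) * S x) =
        fun x => a / v * S x ^ 2 - S x / √v * f (S x / √v) := by
      ext x; ring
    have e2 : (fun x => h (S x / √v)) = fun x => f' (S x / √v) - S x / √v * f (S x / √v) +
        ∫ s, h s ∂stdGaussian := by
      ext x; rw [hstein]; ring
    rw [e1, integral_sub i1 i2, integral_const_mul, hv, div_mul_cancel₀ _ hv0.ne', e2,
      integral_add i3 (integrable_const _), integral_sub hf'i i2]
    simp
    ring
  rw [hSm, mul_zero, sub_zero, hlhs] at hid
  rw [hid]
  refine abs_integral_sin_mul_le fun t => ?_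
  set T : (ι → ℝ) × (ι → ℝ) → ℝ :=
    fun p => kernelFun Γ g' (Sum.elim p.1 (Real.cos t • p.1 + Real.sin t • p.2)) with hT
  have hTc : Continuous T := by
    simp only [hT, kernelFun, Sum.elim_inl, Sum.elim_inr]
    fun_prop
  obtain ⟨B, hB⟩ := (hasBddGradient_kernelFun hμ.symm hg').bdd
  have hTb : ∀ p, |T p| ≤ B := fun p => hB _
  set m := ∫ p, T p ∂(μ.prod μ) with hm
  have hTi : Integrable T (μ.prod μ) := integrable_of_continuous_of_bdd hTc hTb
  have hT2 : Integrable (fun p => T p ^ 2) (μ.prod μ) := by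
    refine integrable_of_continuous_of_bdd (M := B ^ 2) (by fun_prop) fun p => ?_
    rw [abs_pow]
    exact pow_le_pow_left₀ (abs_nonneg _) (hTb p) 2
  have hwb : ∀ p, |T p - m| ≤ B + |m| := fun p =>
    (abs_sub _ _).trans (by linarith [hTb p])
  have hvar : ∫ p, (T p - m) ^ 2 ∂(μ.prod μ) ≤ 4 * A * R ^ 3 * Fintype.card ι := by
    refine le_trans (le_of_eq ?_) (hμ.variance_kernel_le hg' hR hA hA' t)
    have e : (fun p => (T p - m) ^ 2) = fun p => T p ^ 2 - 2 * m * T p + m ^ 2 := by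
      ext p; ring
    have i1 : Integrable (fun p => 2 * m * T p) (μ.prod μ) := hTi.const_mul _
    have i2 : Integrable (fun p => T p ^ 2 - 2 * m * T p) (μ.prod μ) := hT2.sub i1
    rw [e, integral_add i2 (integrable_const _), integral_sub hT2 i1, integral_const_mul, ← hm]
    simp
    ring
  have hJ : ∫ p, ∑ j, ∑ k, Γ j k * ((a - f' (S p.1 / √v)) / v * g' (p.1 j) *
        (1 * g' ((Real.cos t • p.1 + Real.sin t • p.2) k))) ∂(μ.prod μ) =
      (1 / v) * ∫ p, (a - f' (S p.1 / √v)) * (T p - m) ∂(μ.prod μ) := by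
    have hz : ∫ p : (ι → ℝ) × (ι → ℝ), (a - f' (S p.1 / √v)) * m ∂(μ.prod μ) = 0 := by
      rw [integral_mul_const, integral_fun_fst (fun x => a - f' (S x / √v)),
        integral_sub (integrable_const _) hf'i]
      simp [ha]
    have i1 : Integrable (fun p : (ι → ℝ) × (ι → ℝ) => (a - f' (S p.1 / √v)) * T p) (μ.prod μ) :=
      hTi.bdd_mul (c := 4) (Continuous.aestronglyMeasurable (by fun_prop))
        (ae_of_all _ fun p => hb4 _)
    have i2 : Integrable (fun p : (ι → ℝ) × (ι → ℝ) => (a - f' (S p.1 / √v)) * m) (μ.prod μ) :=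
      (integrable_const m).bdd_mul (c := 4) (Continuous.aestronglyMeasurable (by fun_prop))
        (ae_of_all _ fun p => hb4 _)
    simp_rw [mul_sub]
    rw [integral_sub i1 i2, hz, sub_zero, ← integral_const_mul]
    congr 1
    ext p
    simp only [hT, kernelFun, Sum.elim_inl, Sum.elim_inr, Finset.mul_sum]
    exact Finset.sum_congr rfl fun j _ => Finset.sum_congr rfl fun k _ => by ring
  rw [hJ, abs_mul, abs_of_pos (one_div_pos.2 hv0)]
  have hfin : |∫ p, (a - f' (S p.1 / √v)) * (T p - m) ∂(μ.prod μ)| ≤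
      4 * √(4 * A * R ^ 3 * Fintype.card ι) := by
    rw [← Real.norm_eq_abs]
    refine (norm_integral_le_of_norm_le (g := fun p => 4 * |T p - m|) ?_
      (ae_of_all _ fun p => ?_)).trans ?_
    · exact (hTi.sub (integrable_const m)).abs.const_mul 4
    · rw [norm_mul]
      exact mul_le_mul_of_nonneg_right (hb4 _) (norm_nonneg _)
    · rw [integral_const_mul]
      exact mul_le_mul_of_nonneg_left ((integral_abs_le_sqrt (by fun_prop) hwb).trans
        (Real.sqrt_le_sqrt hvar)) (by norm_num)
  calc 1 / v * |∫ p, (a - f' (S p.1 / √v)) * (T p - m) ∂(μ.prod μ)|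
      ≤ 1 / v * (4 * √(4 * A * R ^ 3 * Fintype.card ι)) :=
        mul_le_mul_of_nonneg_left hfin (one_div_pos.2 hv0).le
    _ = 4 / v * √(4 * A * R ^ 3 * Fintype.card ι) := by ring

end Smooth

/-! ### Hermite expansions and covariances -/

section Hermite

lemma derivative_hermite_succ (m : ℕ) :
    Polynomial.derivative (Polynomial.hermite (m + 1)) =
      ((m : Polynomial ℤ) + 1) * Polynomial.hermite m := by
  induction m with
  | zero => simp
  | succ m ih =>
    rw [Polynomial.hermite_succ (m + 1), Polynomial.derivative_sub, Polynomial.derivative_mul, ih,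
      Polynomial.derivative_X, Polynomial.derivative_mul]
    have h : Polynomial.derivative ((m : Polynomial ℤ) + 1) = 0 := by
      simp
    rw [h]
    have h2 := Polynomial.hermite_succ m
    push_cast
    linear_combination -((m : Polynomial ℤ) + 1) * h2

lemma hermiteFun_zero (x : ℝ) : hermiteFun 0 x = 1 := by simp [hermiteFun]

lemma memLp_aeval_stdGaussian (p : Polynomial ℤ) :
    MemLp (fun x : ℝ => Polynomial.aeval x p) 2 stdGaussian := by
  have hpow : ∀ k : ℕ, MemLp (fun x : ℝ => x ^ k) 2 stdGaussian := by
    intro k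
    rw [memLp_two_iff_integrable_sq (by fun_prop)]
    have h := (memLp_id_gaussianReal (μ := 0) (v := 1) ((2 * k : ℕ) : NNReal)).integrable_norm_pow'
    refine (h.congr (ae_of_all _ fun x => ?_))
    simp only [id, Real.norm_eq_abs, pow_mul, sq_abs]
    ring
  simp_rw [Polynomial.aeval_eq_sum_range, zsmul_eq_mul]
  exact memLp_finsetSum _ fun k _ => (hpow k).const_mul _

lemma memLp_hermiteFun (m : ℕ) : MemLp (hermiteFun m) 2 stdGaussian :=
  memLp_aeval_stdGaussian _

variable {ι : Type*} {μ : Measure (ι → ℝ)} {Γ : ι → ι → ℝ}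

lemma IsUnitGaussian.memLp_comp_eval (hμ : IsUnitGaussian μ Γ) {f : ℝ → ℝ} {p : ℝ≥0∞}
    (hf : MemLp f p stdGaussian) (i : ι) : MemLp (fun x => f (x i)) p μ := by
  rw [← hμ.map_eval i] at hf
  exact hf.comp_of_map (measurable_pi_apply i).aemeasurable

lemma IsUnitGaussian.eLpNorm_comp_eval (hμ : IsUnitGaussian μ Γ) {f : ℝ → ℝ} {p : ℝ≥0∞}
    (hf : AEStronglyMeasurable f stdGaussian) (i : ι) :
    eLpNorm (fun x : ι → ℝ => f (x i)) p μ = eLpNorm f p stdGaussian := by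
  rw [← hμ.map_eval i] at hf
  rw [← hμ.map_eval i, eLpNorm_map_measure hf (measurable_pi_apply i).aemeasurable]
  rfl

variable {g : ℝ → ℝ} {c : ℕ → ℝ} {d : ℕ}

lemma memLp_hermite_sum (c : ℕ → ℝ) (N : ℕ) :
    MemLp (fun x => ∑ m ∈ Finset.range N, c m * hermiteFun m x) 2 stdGaussian :=
  memLp_finsetSum _ fun m _ => (memLp_hermiteFun m).const_mul _

lemma IsUnitGaussian.tendsto_eLpNorm_hermite (hμ : IsUnitGaussian μ Γ)
    (hg : HasHermiteRank g d c) (i : ι) :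
    Tendsto (fun N : ℕ => eLpNorm ((fun x : ι → ℝ => ∑ m ∈ Finset.range N,
      c m * hermiteFun m (x i)) - fun x => g (x i)) 2 μ) atTop (𝓝 0) := by
  refine hg.tendsto.congr fun N => ?_
  have h := hμ.eLpNorm_comp_eval (p := 2)
    ((memLp_hermite_sum c N).sub hg.memLp).aestronglyMeasurable i
  rw [eLpNorm_sub_comm] at h
  exact h.symm

variable [Fintype ι]

lemma IsUnitGaussian.abs_cov_le_one (hμ : IsUnitGaussian μ Γ) (i j : ι) : |Γ i j| ≤ 1 := by
  have hi : ∀ i j, Integrable (fun x : ι → ℝ => x i * x j) μ := fun i j =>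
    (hμ.memLp_eval i 2 (by simp)).integrable_mul (hμ.memLp_eval j 2 (by simp))
  have h : Integrable (fun x : ι → ℝ => (x i * x i + x j * x j) / 2) μ :=
    ((hi i i).add (hi j j)).div_const 2
  rw [← hμ.cov, ← Real.norm_eq_abs]
  refine (norm_integral_le_of_norm_le h (ae_of_all _ fun x => ?_)).trans (le_of_eq ?_)
  · rw [Real.norm_eq_abs, abs_le]
    constructor <;> nlinarith [sq_nonneg (x i - x j), sq_nonneg (x i + x j)]
  · rw [integral_div, integral_add (hi i i) (hi j j), hμ.cov, hμ.cov, hμ.unit, hμ.unit]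
    norm_num

/-- Lowering the degree of a Hermite polynomial by integration by parts. -/
lemma IsUnitGaussian.integral_hermite_succ_mul (hμ : IsUnitGaussian μ Γ) (i j : ι) (m : ℕ)
    (p : Polynomial ℤ) :
    ∫ x, hermiteFun (m + 1) (x i) * Polynomial.aeval (x j) p ∂μ =
      Γ i j * ∫ x, hermiteFun m (x i) * Polynomial.aeval (x j) (Polynomial.derivative p) ∂μ := by
  have hL : ∀ (q : Polynomial ℤ) (i : ι), MemLp (fun x : ι → ℝ => Polynomial.aeval (x i) q) 2 μ :=
    fun q i => hμ.memLp_comp_eval (memLp_aeval_stdGaussian q) i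
  have hI : ∀ q q' : Polynomial ℤ, Integrable (fun x : ι → ℝ => Polynomial.aeval (x i) q *
      Polynomial.aeval (x j) q') μ := fun q q' => (hL q i).integrable_mul (hL q' j)
  set H := Polynomial.hermite m with hH
  have hd : ∀ x : ι → ℝ, HasFDerivAt (fun x : ι → ℝ => Polynomial.aeval (x i) H *
      Polynomial.aeval (x j) p)
      (Polynomial.aeval (x i) H • (Polynomial.aeval (x j) (Polynomial.derivative p) •
        (ContinuousLinearMap.proj j : (ι → ℝ) →L[ℝ] ℝ)) +
      Polynomial.aeval (x j) p • (Polynomial.aeval (x i) (Polynomial.derivative H) •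
        (ContinuousLinearMap.proj i : (ι → ℝ) →L[ℝ] ℝ))) x := by
    intro x
    have hev : ∀ (q : Polynomial ℤ) (k : ι), HasFDerivAt (fun x : ι → ℝ => Polynomial.aeval (x k) q)
        (Polynomial.aeval (x k) (Polynomial.derivative q) •
          (ContinuousLinearMap.proj k : (ι → ℝ) →L[ℝ] ℝ)) x := fun q k =>
      hasFDerivAt_comp_eval (u := fun s => Polynomial.aeval s q) (q.hasDerivAt_aeval (x k))
    exact (hev H i).mul (hev p j)
  have hcalc : ∀ x : ι → ℝ, (Polynomial.aeval (x i) H • (Polynomial.aeval (x j)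
        (Polynomial.derivative p) • (ContinuousLinearMap.proj j : (ι → ℝ) →L[ℝ] ℝ)) +
      Polynomial.aeval (x j) p • (Polynomial.aeval (x i) (Polynomial.derivative H) •
        (ContinuousLinearMap.proj i : (ι → ℝ) →L[ℝ] ℝ))) (Γ i) =
      Γ i j * (Polynomial.aeval (x i) H * Polynomial.aeval (x j) (Polynomial.derivative p)) +
        Polynomial.aeval (x i) (Polynomial.derivative H) * Polynomial.aeval (x j) p := by
    intro x
    simp [hμ.unit]
    ring
  have e : (fun x : ι → ℝ => x i * (Polynomial.aeval (x i) H * Polynomial.aeval (x j) p)) =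
      fun x => Polynomial.aeval (x i) (Polynomial.X * H) * Polynomial.aeval (x j) p := by
    ext x; simp; ring
  have h := hμ.integral_eval_mul i hd (hI _ _) (by rw [e]; exact hI _ _)
    (by simp_rw [hcalc]; exact ((hI _ _).const_mul _).add (hI _ _))
  simp_rw [hcalc] at h
  rw [e, integral_add ((hI _ _).const_mul _) (hI _ _), integral_const_mul] at h
  have e2 : (fun x : ι → ℝ => hermiteFun (m + 1) (x i) * Polynomial.aeval (x j) p) =
      fun x => Polynomial.aeval (x i) (Polynomial.X * H) * Polynomial.aeval (x j) p -
        Polynomial.aeval (x i) (Polynomial.derivative H) * Polynomial.aeval (x j) p := by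
    ext x
    simp [hermiteFun, Polynomial.hermite_succ, hH, sub_mul]
  rw [e2, integral_sub (hI _ _) (hI _ _), h]
  simp [hermiteFun, hH]

/-- Orthogonality of the Hermite polynomials of two correlated Gaussian variables. -/
lemma IsUnitGaussian.integral_hermite_mul_hermite (hμ : IsUnitGaussian μ Γ) (i j : ι) (m l : ℕ) :
    ∫ x, hermiteFun m (x i) * hermiteFun l (x j) ∂μ =
      if m = l then (m ! : ℝ) * Γ i j ^ m else 0 := by
  have := hμ.isProbabilityMeasure
  induction m generalizing l with
  | zero =>
    rcases l with - | l
    · simp [hermiteFun_zero]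
    · have h := hμ.integral_hermite_succ_mul j i l (Polynomial.hermite 0)
      simp only [Polynomial.hermite_zero, Polynomial.derivative_C, map_zero, mul_zero,
        integral_zero] at h
      simpa [hermiteFun_zero] using h
  | succ m ih =>
    have h := hμ.integral_hermite_succ_mul i j m (Polynomial.hermite l)
    change ∫ x, hermiteFun (m + 1) (x i) * hermiteFun l (x j) ∂μ = _ at h
    rw [h]
    rcases l with - | l
    · simp
    · rw [derivative_hermite_succ]
      have e : (fun x : ι → ℝ => hermiteFun m (x i) * Polynomial.aeval (x j)
          (((l : Polynomial ℤ) + 1) * Polynomial.hermite l)) =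
          fun x => (l + 1 : ℝ) * (hermiteFun m (x i) * hermiteFun l (x j)) := by
        ext x
        simp [hermiteFun]
        ring
      rw [e, integral_const_mul, ih l]
      by_cases hml : m = l
      · subst hml
        simp [Nat.factorial_succ]
        ring
      · simp [hml]

/-- The integral of a product is continuous along `L²`-convergent sequences. -/
lemma tendsto_integral_mul {α : Type*} [MeasurableSpace α] {ν : Measure α}
    {f h : ℕ → α → ℝ} {f₀ h₀ : α → ℝ}
    (hf : ∀ n, MemLp (f n) 2 ν) (hh : ∀ n, MemLp (h n) 2 ν) (hf₀ : MemLp f₀ 2 ν)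
    (hh₀ : MemLp h₀ 2 ν) (hft : Tendsto (fun n => eLpNorm (f n - f₀) 2 ν) atTop (𝓝 0))
    (hht : Tendsto (fun n => eLpNorm (h n - h₀) 2 ν) atTop (𝓝 0)) :
    Tendsto (fun n => ∫ x, f n x * h n x ∂ν) atTop (𝓝 (∫ x, f₀ x * h₀ x ∂ν)) := by
  have key : ∀ {a b : α → ℝ} (ha : MemLp a 2 ν) (hb : MemLp b 2 ν),
      inner ℝ (hb.toLp b) (ha.toLp a) = ∫ x, a x * b x ∂ν := by
    intro a b ha hb
    rw [L2.inner_def]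
    refine integral_congr_ae ?_
    filter_upwards [ha.coeFn_toLp, hb.coeFn_toLp] with x h1 h2
    rw [h1, h2]
    simp
  have hf' := (Lp.tendsto_Lp_iff_tendsto_eLpNorm'' f hf f₀ hf₀).2 hft
  have hh' := (Lp.tendsto_Lp_iff_tendsto_eLpNorm'' h hh h₀ hh₀).2 hht
  have := hh'.inner (𝕜 := ℝ) hf'
  simpa only [key] using this

lemma IsUnitGaussian.tendsto_hermite_covariance (hμ : IsUnitGaussian μ Γ)
    (hg : HasHermiteRank g d c) (i j : ι) :
    Tendsto (fun N => ∑ m ∈ Finset.range N, (m ! : ℝ) * c m ^ 2 * Γ i j ^ m) atTop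
      (𝓝 (∫ x, g (x i) * g (x j) ∂μ)) := by
  have h := tendsto_integral_mul (fun N => hμ.memLp_comp_eval (memLp_hermite_sum c N) i)
    (fun N => hμ.memLp_comp_eval (memLp_hermite_sum c N) j) (hμ.memLp_comp_eval hg.memLp i)
    (hμ.memLp_comp_eval hg.memLp j) (hμ.tendsto_eLpNorm_hermite hg i)
    (hμ.tendsto_eLpNorm_hermite hg j)
  refine h.congr fun N => ?_
  have hI : ∀ m l, Integrable (fun x : ι → ℝ => c m * hermiteFun m (x i) *
      (c l * hermiteFun l (x j))) μ := fun m l =>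
    ((hμ.memLp_comp_eval (memLp_hermiteFun m) i).const_mul (c m)).integrable_mul
      ((hμ.memLp_comp_eval (memLp_hermiteFun l) j).const_mul (c l))
  simp_rw [Finset.sum_mul_sum]
  rw [integral_finsetSum _ fun m _ => integrable_finsetSum _ fun l _ => hI m l]
  refine Finset.sum_congr rfl fun m hm => ?_
  rw [integral_finsetSum _ fun l _ => hI m l]
  have e : ∀ l, ∫ x, c m * hermiteFun m (x i) * (c l * hermiteFun l (x j)) ∂μ =
      if m = l then (m ! : ℝ) * c m ^ 2 * Γ i j ^ m else 0 := by
    intro l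
    have : (fun x : ι → ℝ => c m * hermiteFun m (x i) * (c l * hermiteFun l (x j))) =
        fun x => c m * c l * (hermiteFun m (x i) * hermiteFun l (x j)) := by
      ext x; ring
    rw [this, integral_const_mul, hμ.integral_hermite_mul_hermite]
    split_ifs with h
    · subst h; ring
    · simp
  simp_rw [e]
  rw [Finset.sum_ite_eq, if_pos hm]

lemma IsUnitGaussian.summable_hermite_coeff (hμ : IsUnitGaussian μ Γ)
    (hg : HasHermiteRank g d c) (i : ι) : Summable fun m : ℕ => (m ! : ℝ) * c m ^ 2 := by
  have h := hμ.tendsto_hermite_covariance hg i i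
  simp only [hμ.unit, one_pow, mul_one] at h
  exact ((hasSum_iff_tendsto_nat_of_nonneg (fun m => by positivity) _).2 h).summable

/-- The covariance of `g (x i)` and `g (x j)` in terms of the Hermite coefficients of `g`. -/
lemma IsUnitGaussian.hasSum_hermite_covariance (hμ : IsUnitGaussian μ Γ)
    (hg : HasHermiteRank g d c) (i j : ι) :
    HasSum (fun m : ℕ => (m ! : ℝ) * c m ^ 2 * Γ i j ^ m) (∫ x, g (x i) * g (x j) ∂μ) := by
  refine (Summable.hasSum_iff_tendsto_nat ?_).2 (hμ.tendsto_hermite_covariance hg i j)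
  refine Summable.of_norm_bounded (hμ.summable_hermite_coeff hg i) fun m => ?_
  rw [norm_mul, Real.norm_of_nonneg (by positivity), norm_pow]
  exact mul_le_of_le_one_right (by positivity)
    (pow_le_one₀ (norm_nonneg _) (hμ.abs_cov_le_one i j))

lemma IsUnitGaussian.integral_eq_zero_of_hermiteRank (hμ : IsUnitGaussian μ Γ)
    (hg : HasHermiteRank g d c) (hd : 0 < d) (i : ι) : ∫ s, g s ∂stdGaussian = 0 := by
  have := hμ.isProbabilityMeasure
  have h := tendsto_integral_mul (fun N => hμ.memLp_comp_eval (memLp_hermite_sum c N) i)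
    (fun _ => memLp_const (1 : ℝ)) (hμ.memLp_comp_eval hg.memLp i)
    (memLp_const (1 : ℝ)) (hμ.tendsto_eLpNorm_hermite hg i) (by simp)
  have e : ∫ x, g (x i) * 1 ∂μ = ∫ s, g s ∂stdGaussian := by
    have hm := hg.memLp.aestronglyMeasurable
    rw [← hμ.map_eval i] at hm ⊢
    rw [integral_map (measurable_pi_apply i).aemeasurable hm]
    simp
  rw [e] at h
  refine tendsto_nhds_unique h (tendsto_const_nhds.congr fun N => ?_)
  simp only [mul_one]
  rw [integral_finsetSum _ fun m _ =>
    ((hμ.memLp_comp_eval (memLp_hermiteFun m) i).integrable (by simp)).const_mul _]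
  refine (Finset.sum_eq_zero fun m _ => ?_).symm
  rw [integral_const_mul]
  rcases m with - | m
  · rw [hg.coeff_eq_zero 0 hd, zero_mul]
  · have h0 := hμ.integral_hermite_mul_hermite i i (m + 1) 0
    simp only [hermiteFun_zero, mul_one] at h0
    rw [h0]
    simp

end Hermite

/-! ### Approximation of functions in the Gaussian Sobolev space -/

section Sobolev

lemma IsSmoothBounded.hasBddDeriv {f : ℝ → ℝ} (hf : IsSmoothBounded f) (i : ℕ) :
    HasBddDeriv (iteratedDeriv i f) (iteratedDeriv (i + 1) f) where
  bdd := hf.2 i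
  hasDerivAt x := by
    rw [iteratedDeriv_succ]
    exact (hf.1.differentiable_iteratedDeriv i (by exact_mod_cast ENat.natCast_lt_top i) x).hasDerivAt
  cont := hf.1.continuous_iteratedDeriv _ (by exact_mod_cast le_top)
  bdd_deriv := hf.2 (i + 1)

lemma HasBddDeriv.sub_const {u u' : ℝ → ℝ} (hu : HasBddDeriv u u') (a : ℝ) :
    HasBddDeriv (fun x => u x - a) u' where
  bdd := by
    obtain ⟨M, hM⟩ := hu.bdd
    exact ⟨M + |a|, fun x => (abs_sub _ _).trans (by linarith [hM x])⟩
  hasDerivAt x := (hu.hasDerivAt x).sub_const a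
  cont := hu.cont
  bdd_deriv := hu.bdd_deriv

lemma HasBddDeriv.memLp {u u' : ℝ → ℝ} (hu : HasBddDeriv u u') (p : ℝ≥0∞) :
    MemLp u p stdGaussian := by
  obtain ⟨M, hM⟩ := hu.bdd
  exact MemLp.of_bound hu.continuous.aestronglyMeasurable M (ae_of_all _ hM)

lemma integral_pow_four_le {α : Type*} [MeasurableSpace α] {ν : Measure α} {f : α → ℝ}
    (hf : MemLp f 4 ν) {K : ℝ} (hK : 0 ≤ K) (h : eLpNorm f 4 ν ≤ ENNReal.ofReal K) :
    ∫ x, f x ^ 4 ∂ν ≤ K ^ 4 := by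
  rw [hf.eLpNorm_eq_integral_rpow_norm (by simp) (by simp), ENNReal.ofReal_le_ofReal_iff hK] at h
  have e : ∫ x, ‖f x‖ ^ (4 : ℝ≥0∞).toReal ∂ν = ∫ x, f x ^ 4 ∂ν := by
    congr 1
    ext x
    have : (4 : ℝ≥0∞).toReal = ((4 : ℕ) : ℝ) := by simp
    rw [this, Real.rpow_natCast, Real.norm_eq_abs]
    exact Even.pow_abs (by decide) _
  rw [e] at h
  have h0 : 0 ≤ ∫ x, f x ^ 4 ∂ν := integral_nonneg fun x => by positivity
  have h2 := pow_le_pow_left₀ (Real.rpow_nonneg h0 _) h 4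
  rwa [← Real.rpow_natCast, ← Real.rpow_mul h0, show ((4 : ℝ≥0∞).toReal)⁻¹ * ((4 : ℕ) : ℝ) = 1 by
    simp, Real.rpow_one] at h2

lemma eventually_integral_pow_four_le {f : ℕ → ℝ → ℝ} {D : ℝ → ℝ}
    (hf : ∀ m, MemLp (f m) 4 stdGaussian) (hD : MemLp D 4 stdGaussian)
    (h : Tendsto (fun m => eLpNorm (f m - D) 4 stdGaussian) atTop (𝓝 0)) :
    ∃ A, ∀ᶠ m in atTop, ∫ x, f m x ^ 4 ∂stdGaussian ≤ A := by
  refine ⟨((eLpNorm D 4 stdGaussian).toReal + 1) ^ 4, ?_⟩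
  filter_upwards [h.eventually_le_const (show (0 : ℝ≥0∞) < 1 by simp)] with m hm
  refine integral_pow_four_le (hf m) (by positivity) ?_
  rw [ENNReal.ofReal_add (by positivity) (by norm_num), ENNReal.ofReal_toReal hD.eLpNorm_ne_top,
    ENNReal.ofReal_one]
  calc eLpNorm (f m) 4 stdGaussian = eLpNorm (D + (f m - D)) 4 stdGaussian := by simp
    _ ≤ eLpNorm D 4 stdGaussian + eLpNorm (f m - D) 4 stdGaussian :=
      eLpNorm_add_le hD.aestronglyMeasurable ((hf m).sub hD).aestronglyMeasurable (by norm_num)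
    _ ≤ _ := by gcongr

/-- A centered `g ∈ 𝔻^{2,4}` is the limit, in `L²(γ)` and almost everywhere, of centered smooth
functions whose first two derivatives are bounded in `L⁴(γ)`. -/
lemma MemGaussianSobolev.exists_approx {g : ℝ → ℝ} (hg : MemGaussianSobolev 2 4 g)
    (hmean : ∫ s, g s ∂stdGaussian = 0) :
    ∃ (A : ℝ) (f f' f'' : ℕ → ℝ → ℝ), (∀ m, HasBddDeriv (f m) (f' m)) ∧
      (∀ m, HasBddDeriv (f' m) (f'' m)) ∧ (∀ m, ∫ s, f m s ∂stdGaussian = 0) ∧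
      (∀ m, ∫ s, f' m s ^ 4 ∂stdGaussian ≤ A) ∧ (∀ m, ∫ s, f'' m s ^ 4 ∂stdGaussian ≤ A) ∧
      Tendsto (fun m => eLpNorm (f m - g) 2 stdGaussian) atTop (𝓝 0) ∧
      ∀ᵐ s ∂stdGaussian, Tendsto (fun m => f m s) atTop (𝓝 (g s)) := by
  obtain ⟨D, hD0, hDL, F, hF, hlim⟩ := hg
  have hFd : ∀ i m, HasBddDeriv (iteratedDeriv i (F m)) (iteratedDeriv (i + 1) (F m)) :=
    fun i m => (hF m).hasBddDeriv i
  have hg4 : MemLp g 4 stdGaussian := hD0 ▸ hDL 0 (by norm_num)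
  have hg2 : MemLp g 2 stdGaussian := hg4.mono_exponent (by norm_num)
  have hF0 : ∀ m, HasBddDeriv (F m) (iteratedDeriv 1 (F m)) := fun m => by
    simpa using hFd 0 m
  have hF2 : ∀ m, MemLp (F m) 2 stdGaussian := fun m => (hF0 m).memLp 2
  have hlim2 : Tendsto (fun m => eLpNorm (F m - g) 2 stdGaussian) atTop (𝓝 0) := by
    have h4 := hlim 0 (by norm_num)
    simp only [iteratedDeriv_zero, hD0] at h4
    exact tendsto_of_tendsto_of_tendsto_of_le_of_le tendsto_const_nhds h4 (fun _ => zero_le)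
      fun m => eLpNorm_le_eLpNorm_of_exponent_le (by norm_num)
        ((hF2 m).sub hg2).aestronglyMeasurable
  set a : ℕ → ℝ := fun m => ∫ s, F m s ∂stdGaussian with ha
  have ha0 : Tendsto a atTop (𝓝 0) := by
    have := tendsto_integral_mul hF2 (fun _ => memLp_const (1 : ℝ)) hg2 (memLp_const (1 : ℝ))
      hlim2 (by simp)
    simpa [hmean] using this
  have hlim3 : Tendsto (fun m => eLpNorm ((fun s => F m s - a m) - g) 2 stdGaussian) atTop
      (𝓝 0) := by
    have hsum : Tendsto (fun m => eLpNorm (F m - g) 2 stdGaussian + ‖a m‖ₑ) atTop (𝓝 0) := by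
      simpa using hlim2.add ha0.enorm
    refine tendsto_of_tendsto_of_tendsto_of_le_of_le tendsto_const_nhds hsum (fun _ => zero_le)
      fun m => ?_
    have e : (fun s => F m s - a m) - g = (F m - g) - fun _ => a m := by
      ext s; simp; ring
    simp only
    rw [e]
    refine (eLpNorm_sub_le ((hF2 m).sub hg2).aestronglyMeasurable
      aestronglyMeasurable_const (by norm_num)).trans (le_of_eq ?_)
    rw [eLpNorm_const _ (by norm_num) (NeZero.ne _)]
    simp
  obtain ⟨A₁, hA₁⟩ := eventually_integral_pow_four_le (fun m => (hFd 1 m).memLp 4)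
    (hDL 1 (by norm_num)) (hlim 1 (by norm_num))
  obtain ⟨A₂, hA₂⟩ := eventually_integral_pow_four_le (fun m => (hFd 2 m).memLp 4)
    (hDL 2 le_rfl) (hlim 2 le_rfl)
  obtain ⟨N, hN⟩ := eventually_atTop.1 (hA₁.and hA₂)
  have hmeas : TendstoInMeasure stdGaussian (fun m s => F m s - a m) atTop g :=
    tendstoInMeasure_of_tendsto_eLpNorm (p := 2) (by norm_num)
      (fun m => ((hF0 m).sub_const (a m)).continuous.aestronglyMeasurable)
      hg2.aestronglyMeasurable hlim3
  obtain ⟨ns, hns, hae⟩ := hmeas.exists_seq_tendsto_ae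
  set k : ℕ → ℕ := fun m => ns (m + N) with hk
  have hkt : Tendsto k atTop atTop := hns.tendsto_atTop.comp (tendsto_add_atTop_nat N)
  have hkN : ∀ m, N ≤ k m := fun m => (Nat.le_add_left N m).trans (hns.id_le _)
  refine ⟨max A₁ A₂, fun m s => F (k m) s - a (k m), fun m => iteratedDeriv 1 (F (k m)),
    fun m => iteratedDeriv 2 (F (k m)), fun m => (hF0 _).sub_const _, fun m => hFd 1 _,
    fun m => ?_, fun m => (hN _ (hkN m)).1.trans (le_max_left _ _),
    fun m => (hN _ (hkN m)).2.trans (le_max_right _ _), hlim3.comp hkt, ?_⟩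
  · rw [integral_sub ((hF2 _).integrable (by norm_num)) (integrable_const _)]
    simp [ha]
  · filter_upwards [hae] with s hs
    exact hs.comp (tendsto_add_atTop_nat N)

/-- Normal approximation of `∑ i, g (x i)` for centered `g ∈ 𝔻^{2,4}`; the constant depends on
`g` only. -/
theorem MemGaussianSobolev.exists_abs_integral_sub_le {g : ℝ → ℝ} (hg : MemGaussianSobolev 2 4 g)
    (hmean : ∫ s, g s ∂stdGaussian = 0) :
    ∃ A : ℝ, ∀ {ι : Type} [Fintype ι] {μ : Measure (ι → ℝ)} {Γ : ι → ι → ℝ},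
      IsUnitGaussian μ Γ → ∀ {R v : ℝ}, (∀ i, ∑ j, |Γ i j| ≤ R) →
      ∫ x, (∑ i, g (x i)) ^ 2 ∂μ = v → 0 < v → ∀ h : ℝ → ℝ, Continuous h → (∀ x, 0 ≤ h x) →
      (∀ x, h x ≤ 1) →
      |∫ x, h ((∑ i, g (x i)) / √v) ∂μ - ∫ s, h s ∂stdGaussian| ≤
        4 / v * √(4 * A * R ^ 3 * Fintype.card ι) := by
  have hg2 : MemLp g 2 stdGaussian := by
    obtain ⟨D, hD0, hDL, -⟩ := hg
    exact (hD0 ▸ hDL 0 (by norm_num) : MemLp g 4 stdGaussian).mono_exponent (by norm_num)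
  obtain ⟨A, f, f', f'', hf, hf', hf0, hA, hA', hlim, hae⟩ := hg.exists_approx hmean
  refine ⟨A, fun {ι} _ {μ Γ} hμ {R v} hR hv hv0 h hc h0 h1 => ?_⟩
  have := hμ.isProbabilityMeasure
  set V : ℕ → ℝ := fun m => ∫ x, (∑ i, f m (x i)) ^ 2 ∂μ with hV
  have hfL : ∀ m i, MemLp (fun x : ι → ℝ => f m (x i)) 2 μ := fun m i =>
    hμ.memLp_comp_eval ((hf m).memLp 2) i
  have hgL : ∀ i, MemLp (fun x : ι → ℝ => g (x i)) 2 μ := fun i => hμ.memLp_comp_eval hg2 i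
  have hlimi : ∀ i, Tendsto (fun m => eLpNorm ((fun x : ι → ℝ => f m (x i)) - fun x => g (x i)) 2 μ)
      atTop (𝓝 0) := fun i => hlim.congr fun m =>
    (hμ.eLpNorm_comp_eval (p := 2) (((hf m).memLp 2).sub hg2).aestronglyMeasurable i).symm
  have hsq : ∀ u : ℝ → ℝ, (∀ i, MemLp (fun x : ι → ℝ => u (x i)) 2 μ) →
      ∫ x, (∑ i, u (x i)) ^ 2 ∂μ = ∑ i, ∑ j, ∫ x, u (x i) * u (x j) ∂μ := by
    intro u hu
    have hI : ∀ i j, Integrable (fun x : ι → ℝ => u (x i) * u (x j)) μ := fun i j =>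
      (hu i).integrable_mul (hu j)
    simp_rw [sq, Finset.sum_mul_sum]
    rw [integral_finsetSum _ fun i _ => integrable_finsetSum _ fun j _ => hI i j]
    exact Finset.sum_congr rfl fun i _ => integral_finsetSum _ fun j _ => hI i j
  have hVlim : Tendsto V atTop (𝓝 v) := by
    rw [← hv, hsq g hgL]
    refine (tendsto_finsetSum _ fun i _ => tendsto_finsetSum _ fun j _ =>
      tendsto_integral_mul (fun m => hfL m i) (fun m => hfL m j) (hgL i) (hgL j) (hlimi i)
        (hlimi j)).congr fun m => ?_
    rw [hV]
    exact (hsq (f m) (hfL m)).symm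
  have hae' : ∀ᵐ x ∂μ, ∀ i, Tendsto (fun m => f m (x i)) atTop (𝓝 (g (x i))) := by
    refine ae_all_iff.2 fun i => ?_
    rw [← hμ.map_eval i] at hae
    exact ae_of_ae_map (measurable_pi_apply i).aemeasurable hae
  have hint : Tendsto (fun m => ∫ x, h ((∑ i, f m (x i)) / √(V m)) ∂μ) atTop
      (𝓝 (∫ x, h ((∑ i, g (x i)) / √v) ∂μ)) := by
    refine tendsto_integral_of_dominated_convergence (fun _ => (1 : ℝ)) (fun m => ?_)
      (integrable_const _) (fun m => ae_of_all _ fun x => ?_) ?_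
    · have := (hf m).continuous
      exact Continuous.aestronglyMeasurable (by fun_prop)
    · rw [Real.norm_of_nonneg (h0 _)]
      exact h1 _
    · filter_upwards [hae'] with x hx
      refine (hc.tendsto _).comp (Tendsto.div (tendsto_finsetSum _ fun i _ => hx i) ?_
        (Real.sqrt_pos.2 hv0).ne')
      exact (Real.continuous_sqrt.tendsto _).comp hVlim
  have hbound : Tendsto (fun m => 4 / V m * √(4 * A * R ^ 3 * Fintype.card ι)) atTop
      (𝓝 (4 / v * √(4 * A * R ^ 3 * Fintype.card ι))) :=
    (tendsto_const_nhds.div hVlim hv0.ne').mul_const _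
  refine le_of_tendsto_of_tendsto (hint.sub_const _).abs hbound ?_
  filter_upwards [hVlim.eventually_const_lt hv0] with m hm
  exact hμ.abs_integral_sub_le (hf m) (hf' m) (hf0 m) hR (hA m) (hA' m) rfl hm hc h0 h1

end Sobolev

/-! ### Asymptotics of the variance -/

section Variance

/-- The double sum of `r (j - i)` over `i, j < n`: the variance of the sum of `n` consecutive
terms of a stationary sequence with covariance function `r`. -/
def doubleSum (r : ℤ → ℝ) (n : ℕ) : ℝ :=
  ∑ i ∈ Finset.range n, ∑ j ∈ Finset.range n, r ((j : ℤ) - i)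

lemma doubleSum_succ_sub (r : ℤ → ℝ) (n : ℕ) :
    doubleSum r (n + 1) - doubleSum r n =
      ∑ k ∈ Finset.range (n + 1), (r k + r (-k)) - r 0 := by
  have h1 : ∑ j ∈ Finset.range n, r ((j : ℤ) - n) = ∑ k ∈ Finset.range n, r (-((k + 1 : ℕ) : ℤ)) := by
    rw [← Finset.sum_range_reflect]
    refine Finset.sum_congr rfl fun j hj => ?_
    have := Finset.mem_range.1 hj
    congr 1
    omega
  have h2 : ∑ j ∈ Finset.range n, r ((n : ℤ) - j) = ∑ k ∈ Finset.range n, r ((k + 1 : ℕ) : ℤ) := by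
    rw [← Finset.sum_range_reflect]
    refine Finset.sum_congr rfl fun j hj => ?_
    have := Finset.mem_range.1 hj
    congr 1
    omega
  rw [Finset.sum_range_succ', Finset.sum_add_distrib, ← h1, ← h2]
  simp only [doubleSum, Finset.sum_range_succ, Finset.sum_add_distrib]
  simp
  ring

/-- The increments of `doubleSum r` are the symmetric partial sums of `r`, so this is a Cesàro
limit. -/
lemma tendsto_doubleSum_div {r : ℤ → ℝ} (hr : Summable r) :
    Tendsto (fun n : ℕ => doubleSum r n / n) atTop (𝓝 (∑' k, r k)) := by
  have h := (hr.hasSum.nat_add_neg.tendsto_sum_nat.comp (tendsto_add_atTop_nat 1)).sub_const (r 0)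
  rw [add_sub_cancel_right] at h
  have hc := Filter.Tendsto.cesaro h
  refine hc.congr fun n => ?_
  have : ∀ i, ((fun n => ∑ k ∈ Finset.range n, (r k + r (-k))) ∘ fun a => a + 1) i - r 0 =
      doubleSum r (i + 1) - doubleSum r i := fun i => (doubleSum_succ_sub r i).symm
  simp_rw [this]
  rw [Finset.sum_range_sub]
  simp [doubleSum, div_eq_inv_mul]

variable {Ω : Type*} [MeasurableSpace Ω] {P : Measure Ω} {X : ℤ → Ω → ℝ}

lemma IsStationaryGaussian.aemeasurable_vec (hX : IsStationaryGaussian X P) {ι : Type*}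
    [Fintype ι] (e : ι → ℤ) : AEMeasurable (fun ω i => X (e i) ω) P :=
  aemeasurable_pi_lambda _ fun _ => hX.gaussian.aemeasurable _

lemma IsStationaryGaussian.isUnitGaussian (hX : IsStationaryGaussian X P) {ι : Type*} [Fintype ι]
    (e : ι → ℤ) : IsUnitGaussian (P.map fun ω i => X (e i) ω) fun i j => rho X P (e j - e i) := by
  have hm := hX.aemeasurable_vec e
  refine ⟨?_, fun i => ?_, fun i j => ?_, fun i => ?_⟩
  · let L : (↥(Finset.univ : Finset ι) → ℝ) →L[ℝ] (ι → ℝ) :=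
      ContinuousLinearMap.pi fun i => ContinuousLinearMap.proj ⟨i, Finset.mem_univ i⟩
    exact (((hX.gaussian.comp_right e).hasGaussianLaw Finset.univ).map L).isGaussian_map
  · rw [integral_map hm (measurable_pi_apply i).aestronglyMeasurable]
    exact hX.centered _
  · rw [integral_map (f := fun x : ι → ℝ => x i * x j) hm
      ((measurable_pi_apply i).mul (measurable_pi_apply j)).aestronglyMeasurable]
    have := hX.stationary (e i) (e j - e i)
    rwa [add_sub_cancel] at this
  · simp only [sub_self, rho]
    simpa [sq] using hX.unit_variance

lemma IsStationaryGaussian.map_eq (hX : IsStationaryGaussian X P) (a : ℤ) :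
    P.map (X a) = stdGaussian := by
  have h := (hX.isUnitGaussian fun _ : Unit => a).map_eval ()
  rwa [AEMeasurable.map_map_of_aemeasurable (measurable_pi_apply _).aemeasurable
    (hX.aemeasurable_vec _)] at h

lemma IsStationaryGaussian.memLp_comp (hX : IsStationaryGaussian X P) {g : ℝ → ℝ} {p : ℝ≥0∞}
    (hg : MemLp g p stdGaussian) (a : ℤ) : MemLp (fun ω => g (X a ω)) p P := by
  rw [← hX.map_eq a] at hg
  exact hg.comp_of_map (hX.gaussian.aemeasurable a)

/-- The covariance of `g (X a)` and `g (X (a + k))`, as a power series in `ρ k` whose coefficients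
come from the Hermite coefficients `c` of `g`. -/
def covFun (c : ℕ → ℝ) (ρ : ℤ → ℝ) (k : ℤ) : ℝ := ∑' m : ℕ, (m ! : ℝ) * c m ^ 2 * ρ k ^ m

variable {g : ℝ → ℝ} {c : ℕ → ℝ}

lemma IsStationaryGaussian.integral_mul_eq (hX : IsStationaryGaussian X P)
    (hg : HasHermiteRank g 1 c) (a b : ℤ) :
    ∫ ω, g (X a ω) * g (X b ω) ∂P = covFun c (rho X P) (b - a) := by
  have hμ := hX.isUnitGaussian ![a, b]
  have h := hμ.hasSum_hermite_covariance hg 0 1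
  rw [integral_map (f := fun x : Fin 2 → ℝ => g (x 0) * g (x 1)) (hX.aemeasurable_vec _)
    ((hμ.memLp_comp_eval hg.memLp 0).aestronglyMeasurable.mul
    (hμ.memLp_comp_eval hg.memLp 1).aestronglyMeasurable)] at h
  exact h.tsum_eq.symm

lemma IsStationaryGaussian.integral_sum_sq (hX : IsStationaryGaussian X P)
    (hg : HasHermiteRank g 1 c) (a : ℤ) (n : ℕ) :
    ∫ ω, (∑ i ∈ Finset.range n, g (X (a + i) ω)) ^ 2 ∂P = doubleSum (covFun c (rho X P)) n := by
  have hI : ∀ i j : ℕ, Integrable (fun ω => g (X (a + i) ω) * g (X (a + j) ω)) P := fun i j =>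
    (hX.memLp_comp hg.memLp _).integrable_mul (hX.memLp_comp hg.memLp _)
  simp_rw [sq, Finset.sum_mul_sum]
  rw [integral_finsetSum _ fun i _ => integrable_finsetSum _ fun j _ => hI i j, doubleSum]
  refine Finset.sum_congr rfl fun i _ => ?_
  rw [integral_finsetSum _ fun j _ => hI i j]
  refine Finset.sum_congr rfl fun j _ => ?_
  rw [hX.integral_mul_eq hg]
  congr 1
  ring

lemma IsStationaryGaussian.abs_rho_le_one (hX : IsStationaryGaussian X P) (k : ℤ) :
    |rho X P k| ≤ 1 := by
  simpa using (hX.isUnitGaussian ![0, k]).abs_cov_le_one 0 1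

/-- The sum of the covariances is the limiting variance. Exchanging the sums over `m` and `k` is
allowed because `|ρ k ^ m| ≤ |ρ k|` for `m ≥ 1`, while the term `m = 0` vanishes with `c 0`. -/
lemma IsStationaryGaussian.hasSum_covFun (hX : IsStationaryGaussian X P)
    (hg : HasHermiteRank g 1 c) (hρ : Summable fun j : ℤ => |rho X P j|) :
    HasSum (covFun c (rho X P)) (limitVariance c (rho X P)) := by
  set ρ := rho X P with hρdef
  have ha : Summable fun m : ℕ => (m ! : ℝ) * c m ^ 2 :=
    (hX.isUnitGaussian fun _ : Unit => 0).summable_hermite_coeff hg ()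
  have hs : Summable fun q : ℕ × ℤ => (q.1 ! : ℝ) * c q.1 ^ 2 * ρ q.2 ^ q.1 := by
    refine Summable.of_norm_bounded (ha.mul_of_nonneg hρ (fun m => by positivity)
      (fun k => abs_nonneg _)) fun q => ?_
    obtain ⟨m, k⟩ := q
    rcases m with - | m
    · simp [hg.coeff_eq_zero 0 one_pos]
    · simp only
      rw [norm_mul, Real.norm_of_nonneg (by positivity), norm_pow, Real.norm_eq_abs]
      exact mul_le_mul_of_nonneg_left (pow_le_of_le_one (abs_nonneg _) (hX.abs_rho_le_one k)
        m.succ_ne_zero) (by positivity)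
  have h1 : limitVariance c ρ = ∑' k, covFun c ρ k := by
    simp_rw [limitVariance, covFun, ← tsum_mul_left]
    exact hs.prod_symm.tsum_comm (f := fun k m => (m ! : ℝ) * c m ^ 2 * ρ k ^ m)
  rw [h1]
  exact hs.prod_symm.prod.hasSum

/-- The variance of a block of consecutive terms is positive: if that of one block of length `n` vanished,
so would that of the blocks of length `N * n`, against the convergence of the normalized variances to a positive limit. -/
lemma IsStationaryGaussian.doubleSum_pos (hX : IsStationaryGaussian X P)
    (hg : HasHermiteRank g 1 c) (hρ : Summable fun j : ℤ => |rho X P j|)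
    (hσ : 0 < limitVariance c (rho X P)) {n : ℕ} (hn : 1 ≤ n) :
    0 < doubleSum (covFun c (rho X P)) n := by
  have hsum := hX.hasSum_covFun hg hρ
  have hlim := tendsto_doubleSum_div hsum.summable
  rw [hsum.tsum_eq] at hlim
  have hnn : 0 ≤ doubleSum (covFun c (rho X P)) n := by
    rw [← hX.integral_sum_sq hg 0]
    exact integral_nonneg fun ω => sq_nonneg _
  refine hnn.lt_of_ne' fun h0 => ?_
  have hL : ∀ (a : ℤ) (N : ℕ), MemLp (fun ω => ∑ i ∈ Finset.range N, g (X (a + i) ω)) 2 P :=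
    fun a N => memLp_finsetSum _ fun i _ => hX.memLp_comp hg.memLp _
  have hblock : ∀ a : ℤ, ∀ᵐ ω ∂P, ∑ i ∈ Finset.range n, g (X (a + i) ω) = 0 := by
    intro a
    have h := hX.integral_sum_sq hg a n
    rw [h0, integral_eq_zero_iff_of_nonneg (fun ω => sq_nonneg _) (hL a n).integrable_sq] at h
    filter_upwards [h] with ω hω
    exact pow_eq_zero_iff two_ne_zero |>.1 hω
  have hmul : ∀ N : ℕ, ∀ᵐ ω ∂P, ∑ i ∈ Finset.range (N * n), g (X (0 + i) ω) = 0 := by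
    intro N
    induction N with
    | zero => simp
    | succ N ih =>
      filter_upwards [ih, hblock ((N * n : ℕ) : ℤ)] with ω h1 h2
      rw [Nat.succ_mul, Finset.sum_range_add, h1, zero_add, ← h2]
      refine Finset.sum_congr rfl fun i _ => ?_
      congr 2
      push_cast
      ring
  have hz : ∀ N : ℕ, doubleSum (covFun c (rho X P)) (N * n) = 0 := by
    intro N
    rw [← hX.integral_sum_sq hg 0, integral_eq_zero_of_ae]
    filter_upwards [hmul N] with ω hω
    rw [hω]
    simp
  have hsub := hlim.comp (tendsto_id.atTop_mul_const' (show 0 < n by omega))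
  have : Tendsto (fun _ : ℕ => (0 : ℝ)) atTop (𝓝 (limitVariance c (rho X P))) :=
    hsub.congr fun N => by simp [hz N]
  exact hσ.ne (tendsto_nhds_unique tendsto_const_nhds this)

lemma sum_abs_sub_le {ρ : ℤ → ℝ} (hρ : Summable fun j : ℤ => |ρ j|) {ι : Type*} [Fintype ι]
    {e : ι → ℤ} (he : Function.Injective e) (a : ℤ) :
    ∑ j, |ρ (e j - a)| ≤ ∑' k, |ρ k| := by
  have hinj : Function.Injective fun j => e j - a := fun i j h => he (by simpa using h)
  rw [← tsum_fintype (L := .unconditional _)]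
  exact tsum_comp_le_tsum_of_inj hρ (fun _ => abs_nonneg _) hinj

end Variance

end BreuerMajor

end

theorem theorem4p1 {Ω : Type*} [MeasurableSpace Ω] (P : Measure Ω) [IsProbabilityMeasure P]
    (X : ℤ → Ω → ℝ) (hX : BreuerMajor.IsStationaryGaussian X P)
    (g : ℝ → ℝ) (hg : BreuerMajor.MemGaussianSobolev 2 4 g)
    (c : ℕ → ℝ) (hrank : BreuerMajor.HasHermiteRank g 1 c)
    (hρ : Summable fun j : ℤ => |BreuerMajor.rho X P j|)
    (hσ : 0 < BreuerMajor.limitVariance c (BreuerMajor.rho X P)) :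
    ∃ C : ℝ, ∀ n : ℕ, 1 ≤ n →
      0 < BreuerMajor.sigma g X P n ∧
      BreuerMajor.tvDist
          (P.map fun ω => BreuerMajor.Y g X n ω / BreuerMajor.sigma g X P n)
          (gaussianReal 0 1) ≤
        C * (n : ℝ) ^ (-(1 / 2) : ℝ) := by
  open BreuerMajor in
  have hmean : ∫ s, g s ∂stdGaussian = 0 :=
    (hX.isUnitGaussian fun _ : Unit => 0).integral_eq_zero_of_hermiteRank hrank one_pos ()
  obtain ⟨A, hA⟩ := hg.exists_abs_integral_sub_le hmean
  set v : ℕ → ℝ := doubleSum (covFun c (rho X P)) with hv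
  set R : ℝ := ∑' k, |rho X P k| with hR
  have hsum := hX.hasSum_covFun hrank hρ
  have hlim := tendsto_doubleSum_div hsum.summable
  rw [hsum.tsum_eq] at hlim
  -- `n / v n` converges, hence is bounded
  obtain ⟨B, hB⟩ := (hlim.inv₀ hσ.ne').bddAbove_range
  refine ⟨4 * B * √(4 * A * R ^ 3), fun n hn => ?_⟩
  have hv0 : 0 < v n := hX.doubleSum_pos hrank hρ hσ hn
  have hn0 : (0 : ℝ) < n := by exact_mod_cast hn
  set S : Ω → ℝ := fun ω => ∑ i ∈ Finset.range n, g (X (1 + i) ω) with hS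
  have hYS : ∀ ω, Y g X n ω = (1 / √(n : ℝ)) * S ω := by
    intro ω
    rw [Y, hS]
    congr 1
    rw [← Finset.Ico_succ_right_eq_Icc, Finset.sum_Ico_eq_sum_range]
    refine Finset.sum_congr (by simp) fun i _ => ?_
    push_cast
    rfl
  have hS2 : ∫ ω, S ω ^ 2 ∂P = v n := hX.integral_sum_sq hrank 1 n
  have hsn : sigma g X P n = √(v n) / √(n : ℝ) := by
    rw [sigma]
    simp_rw [hYS, mul_pow]
    rw [integral_const_mul, hS2, one_div, inv_pow, Real.sq_sqrt hn0.le, ← Real.sqrt_div hv0.le]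
    congr 1
    ring
  refine ⟨by rw [hsn]; positivity, ?_⟩
  have hquot : (fun ω => Y g X n ω / sigma g X P n) = fun ω => S ω / √(v n) := by
    ext ω
    rw [hYS, hsn]
    field_simp
  rw [hquot]
  -- the law of `(X 1, …, X n)`
  set e : Fin n → ℤ := fun i => 1 + (i : ℕ) with he
  have hμ := hX.isUnitGaussian e
  have hvec := hX.aemeasurable_vec e
  have hsumS : ∀ ω, ∑ i, g (X (e i) ω) = S ω := fun ω =>
    Fin.sum_univ_eq_sum_range (fun i : ℕ => g (X (1 + i) ω)) n
  have hGm : AEStronglyMeasurable (fun x : Fin n → ℝ => ∑ i, g (x i))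
      (P.map fun ω i => X (e i) ω) :=
    (memLp_finsetSum Finset.univ fun i _ =>
      hμ.memLp_comp_eval hrank.memLp i).aestronglyMeasurable
  have hSm : AEMeasurable (fun ω => S ω / √(v n)) P :=
    (memLp_finsetSum _ fun i _ =>
      hX.memLp_comp hrank.memLp _).aestronglyMeasurable.aemeasurable.div_const _
  have hG2 : ∫ x : Fin n → ℝ, (∑ i, g (x i)) ^ 2 ∂(P.map fun ω i => X (e i) ω) = v n := by
    rw [integral_map (f := fun x : Fin n → ℝ => (∑ i, g (x i)) ^ 2) hvec (hGm.pow 2), ← hS2]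
    simp_rw [hsumS]
  have hrow : ∀ i, ∑ j, |rho X P (e j - e i)| ≤ R := fun i =>
    sum_abs_sub_le hρ (fun a b hab => Fin.ext (by simpa [he] using hab)) (e i)
  have : IsProbabilityMeasure (P.map fun ω => S ω / √(v n)) := Measure.isProbabilityMeasure_map hSm
  have htv : tvDist (P.map fun ω => S ω / √(v n)) (gaussianReal 0 1) ≤
      4 / v n * √(4 * A * R ^ 3 * n) := by
    refine tvDist_le fun h hc h0 h1 => ?_
    have hb := hA hμ hrow hG2 hv0 h hc h0 h1
    have hhm : AEStronglyMeasurable (fun x : Fin n → ℝ => h ((∑ i, g (x i)) / √(v n)))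
        (P.map fun ω i => X (e i) ω) :=
      hc.comp_aestronglyMeasurable (hGm.aemeasurable.div_const _).aestronglyMeasurable
    rw [integral_map hvec hhm] at hb
    simp_rw [hsumS] at hb
    rw [integral_map hSm hc.aestronglyMeasurable]
    simpa using hb
  refine htv.trans ?_
  have hBn : (n : ℝ) / v n ≤ B := by
    simpa using hB (Set.mem_range_self n)
  rw [Real.sqrt_mul' _ hn0.le, Real.rpow_neg hn0.le, ← Real.sqrt_eq_rpow]
  have hnn : (√(n : ℝ)) = n * (√(n : ℝ))⁻¹ := by
    rw [← div_eq_mul_inv, Real.div_sqrt]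
  calc 4 / v n * (√(4 * A * R ^ 3) * √(n : ℝ))
      = 4 * (n / v n) * √(4 * A * R ^ 3) * (√(n : ℝ))⁻¹ := by
        conv_lhs => rw [hnn]
        ring
    _ ≤ 4 * B * √(4 * A * R ^ 3) * (√(n : ℝ))⁻¹ := by gcongr
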